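/- \textbf{Theorem.} Let $(g_k)_{k\ge1}$, $(g'_k)_{k\ge1}$ be two independent sequences of i.i.d. $\mathcal N(0,1)$ random variables on a probability space $(\Omega,\mathcal A,\mathbb P)$, let $(a_k)_{k\ge 1}$ be real numbers and $(j_k)_{k\ge1}$ a strictly increasing sequence of integers. For real $1\le y\le x$ put $$\widetilde X_{y,x}(t)=\sum_{y\le k\le x}a_k\big(g_k\cos 2\pi j_kt+g'_k\sin 2\pi j_kt\big),\quad 0\le t\le 1,\qquad A(y,x)=\sum_{y\le k\le x}a_k^2 .$$ For every $\delta>0$ there is a constant $C>0$ depending only on $\delta$ (hence an absolute constant once $\delta$ is fixed, e.g. $\delta=1$) such that for all such data and all $0<\varepsilon\le1$ the following holds. (1) Let $0<\eta<1$ and $\eta\log A(y,x)\ge\delta$. If $$\Big(\sum_{y\le k\le x}a_k^4\Big)^{1/2}\le\frac{A(y,x)^{1-\eta}}{\sqrt{\log A(y,x)}},\tag{$*$}$$ then $$\mathbb P\Big\{\sup_{0\le t\le\varepsilon}\widetilde X_{y,x}(t)\le\sqrt{2\eta A(y,x)\log A(y,x)}\Big\}\le\exp\Big(-\frac{C\varepsilon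 A(y,x)^{1-\eta}}{\sqrt{\eta\,(\sum_{y\le k\le x}a_k^4+1)\log A(y,x)}}\Big).$$ If $B=\sum_{k\ge1}a_k^4<\infty$, then $(*)$ holds whenever $A(y,x)\ge A_0$, where $A_0$ depends only on $\eta$ and $B$; and (whenever $\eta\log A(y,x)\ge\delta$) $$\mathbb P\Big\{\sup_{0\le t\le\varepsilon}\widetilde X_{y,x}(t)\le\sqrt{2\eta A(y,x)\log A(y,x)}\Big\}\le\exp\Big(-\frac{C\varepsilon A(y,x)^{1-\eta}}{\sqrt{\eta\,(B+1)\log A(y,x)}}\Big).$$ (2) (Case $\eta=1$.) Let $0<V<A(y,x)$ with $\log(A(y,x)/V)\ge\delta$. Then $$\mathbb P\Big\{\sup_{0\le t\le\varepsilon}\widetilde X_{y,x}(t)\le\sqrt{2A(y,x)\log\frac{A(y,x)}{V}}\Big\}\le\exp\Big(-\frac{C\varepsilon V}{\sqrt{(\sum_{y\le k\le x}a_k^4+1)\log(A(y,x)/V)}}\Big).$$ -/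

import Mathlib

open MeasureTheory ProbabilityTheory

/-- `(g_k)_{k ≥ 1}` and `(g'_k)_{k ≥ 1}` are two independent sequences of independent standard
Gaussian random variables: the whole family `(g_k), (g'_k)`, `k ≥ 1`, is mutually independent and
each member has law `N(0, 1)`. The values at `k = 0` play no role. -/
structure IsStdGaussianPair {Ω : Type*} [MeasurableSpace Ω] (P : Measure Ω)
    (g g' : ℕ → Ω → ℝ) : Prop where
  law_fst : ∀ k, 1 ≤ k → HasLaw (g k) (gaussianReal 0 1) P
  law_snd : ∀ k, 1 ≤ k → HasLaw (g' k) (gaussianReal 0 1) P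
  indep : iIndepFun (fun i : {k : ℕ // 1 ≤ k} ⊕ {k : ℕ // 1 ≤ k} =>
    Sum.elim (fun k => g k.1) (fun k => g' k.1) i) P

/-- The integers `k` with `y ≤ k ≤ x`. -/
noncomputable def window (y x : ℝ) : Finset ℕ := Finset.Icc ⌈y⌉₊ ⌊x⌋₊

theorem mem_window {y x : ℝ} (hx : 0 ≤ x) (k : ℕ) :
    k ∈ window y x ↔ y ≤ (k : ℝ) ∧ (k : ℝ) ≤ x := by
  simp [window, Nat.ceil_le, Nat.le_floor_iff hx]

/-- The Gaussian trigonometric polynomial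
`X_{y,x}(t) = ∑_{y ≤ k ≤ x} a_k (g_k cos(2π j_k t) + g'_k sin(2π j_k t))`. -/
noncomputable def trigPoly {Ω : Type*} (a : ℕ → ℝ) (j : ℕ → ℤ) (g g' : ℕ → Ω → ℝ)
    (y x t : ℝ) (ω : Ω) : ℝ :=
  ∑ k ∈ window y x, a k * (g k ω * Real.cos (2 * Real.pi * j k * t)
    + g' k ω * Real.sin (2 * Real.pi * j k * t))

/-- `sup_{0 ≤ t ≤ ε} X_{y,x}(t)`; the real supremum is a genuine one by
`bddAbove_trigPoly`. -/
noncomputable def supTrigPoly {Ω : Type*} (a : ℕ → ℝ) (j : ℕ → ℤ) (g g' : ℕ → Ω → ℝ)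
    (y x ε : ℝ) (ω : Ω) : ℝ :=
  sSup ((fun t : ℝ => trigPoly a j g g' y x t ω) '' Set.Icc 0 ε)

theorem bddAbove_trigPoly {Ω : Type*} (a : ℕ → ℝ) (j : ℕ → ℤ) (g g' : ℕ → Ω → ℝ)
    (y x ε : ℝ) (ω : Ω) :
    BddAbove ((fun t : ℝ => trigPoly a j g g' y x t ω) '' Set.Icc 0 ε) := by
  refine (isCompact_Icc.image ?_).bddAbove
  unfold trigPoly
  fun_prop

/-- `A(y,x) = ∑_{y ≤ k ≤ x} a_k²`. -/
noncomputable def sumSq (a : ℕ → ℝ) (y x : ℝ) : ℝ := ∑ k ∈ window y x, a k ^ 2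

/-- `∑_{y ≤ k ≤ x} a_k⁴`. -/
noncomputable def sumFourth (a : ℕ → ℝ) (y x : ℝ) : ℝ := ∑ k ∈ window y x, a k ^ 4

/-- The condition `(∑_{y ≤ k ≤ x} a_k⁴)^{1/2} ≤ A(y,x)^{1-η} / √(log A(y,x))`. -/
def FourthCondition (a : ℕ → ℝ) (η y x : ℝ) : Prop :=
  √(sumFourth a y x) ≤ sumSq a y x ^ (1 - η) / √(Real.log (sumSq a y x))

/-! The supremum over `[0, ε]` dominates the maximum over any finite set of points, so it suffices
to find many points of `[0, ε]` at which the polynomial is nearly uncorrelated and to bound the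
probability that all these values lie below the level.

Points. The covariance depends only on the difference `s - t`. Orthogonality of the cosines bounds
its `L²` norm over a period, hence its `L¹` norm, by the root of the sum of fourth powers
(`integral_abs_trigCov_le`). Averaging over `[0, ε]` then lets points be picked greedily
(`exists_greedy_points`), each having total normalised correlation at most 1 with its predecessors,
for about `ε A / √(∑ a_k⁴ + 1)` points. At least half of them have row sum at most 6, so by Schur's
bound the correlation matrix of those is at most 6 times the identity.

Decoupling. If a correlation matrix `R` satisfies `R ≤ p I`, then `P(∀ i, X_i ≤ z) ≤ Φ(z)^(n/p)` for
`z ≥ 0` (`measureReal_forall_linForm_le`). With `w = log (κ + Φ)` and `q_i = (z - X_i sin θ) / cos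
θ`, follow `E ∏ exp (w(q_i) / p)` from `θ = 0`, where it is deterministic, to `θ = π/2`, where it
controls the probability. Gaussian integration by parts and `w'' = -x w' - w'²` turn its derivative
into a nonpositive multiple of `E[∏ exp (w(q_j) / p) · (|v|² - vᵀRv / p)]`, where `v_i = w'(q_i)`;
this is at most 0 because `R ≤ p I`.

Tail. `Φ^e ≤ exp (-e (1 - Φ))` and a lower bound for `1 - Φ(√(2L))` with `L = log (A / V)` give part
(2); part (1) is the choice `V = A^(1-η)`. -/

/-! ### The standard Gaussian law: density, distribution function, tail, Stein's identity. -/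

/-- The density of the standard Gaussian law. -/
noncomputable def stdPdf (x : ℝ) : ℝ := gaussianPDFReal 0 1 x

/-- The distribution function of the standard Gaussian law. -/
noncomputable def stdCdf (x : ℝ) : ℝ := cdf (gaussianReal 0 1) x

theorem stdPdf_eq (x : ℝ) : stdPdf x = (√(2 * Real.pi))⁻¹ * Real.exp (-x ^ 2 / 2) := by
  simp [stdPdf, gaussianPDFReal]

theorem stdPdf_nonneg (x : ℝ) : 0 ≤ stdPdf x := gaussianPDFReal_nonneg 0 1 x

theorem inv_sqrt_two_pi_le_one : (√(2 * Real.pi))⁻¹ ≤ 1 := by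
  apply inv_le_one_of_one_le₀
  rw [Real.one_le_sqrt]
  linarith [Real.pi_gt_three]

theorem stdPdf_le_one (x : ℝ) : stdPdf x ≤ 1 := by
  rw [stdPdf_eq]
  have h : Real.exp (-x ^ 2 / 2) ≤ 1 := Real.exp_le_one_iff.2 (by nlinarith [sq_nonneg x])
  calc _ ≤ (1 : ℝ) * 1 := by
        gcongr
        exact inv_sqrt_two_pi_le_one
    _ = 1 := one_mul 1

theorem abs_mul_stdPdf_le_one (x : ℝ) : |x * stdPdf x| ≤ 1 := by
  rw [stdPdf_eq, abs_mul, abs_mul, abs_of_nonneg (a := (√(2 * Real.pi))⁻¹) (by positivity),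
    Real.abs_exp]
  have h : |x| ≤ Real.exp (x ^ 2 / 2) := by
    have := Real.add_one_le_exp (x ^ 2 / 2)
    nlinarith [sq_abs x, sq_nonneg (|x| - 1)]
  have h2 : Real.exp (-x ^ 2 / 2) = (Real.exp (x ^ 2 / 2))⁻¹ := by
    rw [← Real.exp_neg]; congr 1; ring
  calc |x| * ((√(2 * Real.pi))⁻¹ * Real.exp (-x ^ 2 / 2))
      ≤ Real.exp (x ^ 2 / 2) * (1 * Real.exp (-x ^ 2 / 2)) := by
        gcongr
        exact inv_sqrt_two_pi_le_one
    _ = 1 := by rw [h2, one_mul, mul_inv_cancel₀ (Real.exp_pos _).ne']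

theorem hasDerivAt_stdPdf (x : ℝ) : HasDerivAt stdPdf (-(x * stdPdf x)) x := by
  have h : HasDerivAt (fun x : ℝ => (√(2 * Real.pi))⁻¹ * Real.exp (-x ^ 2 / 2))
      ((√(2 * Real.pi))⁻¹ * (Real.exp (-x ^ 2 / 2) * (-(2 * x) / 2))) x := by
    have h1 : HasDerivAt (fun x : ℝ => -x ^ 2 / 2) (-(2 * x) / 2) x := by
      simpa using ((hasDerivAt_pow 2 x).neg).div_const 2
    exact (h1.exp).const_mul _
  have e : stdPdf = fun x : ℝ => (√(2 * Real.pi))⁻¹ * Real.exp (-x ^ 2 / 2) := funext stdPdf_eq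
  rw [stdPdf_eq x, e]
  convert h using 1
  ring

theorem continuous_stdPdf : Continuous stdPdf :=
  continuous_iff_continuousAt.2 fun x => (hasDerivAt_stdPdf x).continuousAt

theorem integrable_stdPdf : Integrable stdPdf := integrable_gaussianPDFReal 0 1

theorem stdCdf_eq_integral (x : ℝ) : stdCdf x = ∫ t in Set.Iic x, stdPdf t := by
  rw [stdCdf, cdf_eq_real, Measure.real, gaussianReal_apply_eq_integral 0 one_ne_zero,
    ENNReal.toReal_ofReal]
  · rfl
  · exact setIntegral_nonneg measurableSet_Iic fun t _ => gaussianPDFReal_nonneg 0 1 t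

theorem stdCdf_sub_stdCdf (a b : ℝ) : stdCdf b - stdCdf a = ∫ t in a..b, stdPdf t := by
  rw [stdCdf_eq_integral, stdCdf_eq_integral]
  exact intervalIntegral.integral_Iic_sub_Iic integrable_stdPdf.integrableOn
    integrable_stdPdf.integrableOn

theorem hasDerivAt_stdCdf (x : ℝ) : HasDerivAt stdCdf (stdPdf x) x := by
  have h : HasDerivAt (fun u => ∫ t in (0 : ℝ)..u, stdPdf t) (stdPdf x) x :=
    intervalIntegral.integral_hasDerivAt_right (continuous_stdPdf.intervalIntegrable _ _)
      (continuous_stdPdf.stronglyMeasurableAtFilter _ _) continuous_stdPdf.continuousAt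
  have e : stdCdf = fun u => stdCdf 0 + ∫ t in (0 : ℝ)..u, stdPdf t := by
    funext u
    rw [← stdCdf_sub_stdCdf]; ring
  rw [e]
  exact h.const_add _

theorem continuous_stdCdf : Continuous stdCdf :=
  continuous_iff_continuousAt.2 fun x => (hasDerivAt_stdCdf x).continuousAt

theorem stdCdf_nonneg (x : ℝ) : 0 ≤ stdCdf x := cdf_nonneg _ x

theorem stdCdf_le_one (x : ℝ) : stdCdf x ≤ 1 := cdf_le_one _ x

theorem monotone_stdCdf : Monotone stdCdf := monotone_cdf _

theorem tendsto_stdCdf_atTop : Filter.Tendsto stdCdf Filter.atTop (nhds 1) := tendsto_cdf_atTop _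

/-- A lower bound of the Gaussian tail. -/
theorem tail_le_one_sub_stdCdf {z : ℝ} (hz : 0 < z) :
    (√(2 * Real.pi))⁻¹ * (z⁻¹ * Real.exp (-(z + z⁻¹) ^ 2 / 2)) ≤ 1 - stdCdf z := by
  have hzi : 0 < z⁻¹ := inv_pos.2 hz
  -- Only the mass of `[z, z + 1/z]` is kept: `1/z` is the scale on which the density decays beyond
  -- `z`. On it the density is at least its value at the right endpoint.
  have h1 : ∫ t in z..(z + z⁻¹), stdPdf t ≤ 1 - stdCdf z := by
    rw [← stdCdf_sub_stdCdf]
    linarith [stdCdf_le_one (z + z⁻¹)]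
  refine le_trans ?_ h1
  have h2 : ∫ _ in z..(z + z⁻¹), stdPdf (z + z⁻¹) ≤ ∫ t in z..(z + z⁻¹), stdPdf t := by
    refine intervalIntegral.integral_mono_on (by linarith) (by simp)
      (continuous_stdPdf.intervalIntegrable _ _) fun t ht => ?_
    rw [stdPdf_eq, stdPdf_eq]
    gcongr
    · linarith [ht.1]
    · exact ht.2
  refine le_trans (le_of_eq ?_) h2
  rw [intervalIntegral.integral_const, stdPdf_eq, smul_eq_mul]
  ring

/-- Stein's identity: with `φ` the density, `φ' = -xφ`, so `(φ f)' = -φ x f + φ f'`, and an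
integrable derivative of an integrable function has integral zero over the line. -/
theorem integral_mul_gaussian {f f' : ℝ → ℝ} {C C' : ℝ} (hf : ∀ x, HasDerivAt f (f' x) x)
    (hf' : Measurable f') (hC : ∀ x, |f x| ≤ C) (hC' : ∀ x, |f' x| ≤ C') :
    ∫ x, x * f x ∂gaussianReal 0 1 = ∫ x, f' x ∂gaussianReal 0 1 := by
  rw [integral_gaussianReal_eq_integral_smul one_ne_zero,
    integral_gaussianReal_eq_integral_smul one_ne_zero]
  have hfm : Continuous f := continuous_iff_continuousAt.2 fun x => (hf x).continuousAt
  have hid : Integrable (fun x => stdPdf x * x) := by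
    have h := (memLp_id_gaussianReal (μ := 0) (v := 1) 1).integrable le_rfl
    rw [gaussianReal_of_var_ne_zero 0 one_ne_zero, gaussianPDF_def,
      integrable_withDensity_iff_integrable_smul'] at h
    · refine h.congr (Filter.Eventually.of_forall fun x => ?_)
      simp [gaussianPDFReal_nonneg, stdPdf]
    · exact (measurable_gaussianPDFReal 0 1).ennreal_ofReal
    · exact Filter.Eventually.of_forall fun x => ENNReal.ofReal_lt_top
  have i1 : Integrable (fun x => stdPdf x * (x * f x)) := by
    have := hid.mul_bdd (c := C) hfm.aestronglyMeasurable (Filter.Eventually.of_forall hC)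
    refine this.congr (Filter.Eventually.of_forall fun x => ?_)
    simp only; ring
  have i2 : Integrable (fun x => stdPdf x * f' x) :=
    integrable_stdPdf.mul_bdd (c := C') hf'.aestronglyMeasurable (Filter.Eventually.of_forall hC')
  have i0 : Integrable (fun x => stdPdf x * f x) :=
    integrable_stdPdf.mul_bdd (c := C) hfm.aestronglyMeasurable (Filter.Eventually.of_forall hC)
  have key := integral_eq_zero_of_hasDerivAt_of_integrable
    (f := fun x => stdPdf x * f x) (f' := fun x => -(stdPdf x * (x * f x)) + stdPdf x * f' x)
    (fun x => by
      exact ((hasDerivAt_stdPdf x).mul (hf x)).congr_deriv (by ring)) (i1.neg.add i2) i0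
  have h3 := integral_add i1.neg i2
  simp only [Pi.neg_apply] at h3
  rw [integral_neg] at h3
  have h4 : -∫ x, stdPdf x * (x * f x) = -∫ x, stdPdf x * f' x := by linarith
  simpa [stdPdf] using neg_injective h4

/-! ### Integration by parts for the product Gaussian law. -/

section Pi

variable {ι : Type*} [Fintype ι]

/-- Resampling one coordinate independently does not change the product law. This isolates
coordinate `k` as a separate factor for Fubini without splitting the index type. -/
theorem measurePreserving_update [DecidableEq ι] (μ : Measure ℝ) [IsProbabilityMeasure μ] (k : ι) :
    MeasurePreserving (fun z : ℝ × (ι → ℝ) => Function.update z.2 k z.1)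
      (μ.prod (Measure.pi fun _ : ι => μ)) (Measure.pi fun _ : ι => μ) := by
  have hm : Measurable (fun z : ℝ × (ι → ℝ) => Function.update z.2 k z.1) := by
    refine measurable_pi_lambda _ fun i => ?_
    by_cases h : i = k
    · subst h; simpa using measurable_fst
    · simp only [Function.update_of_ne h]
      exact (measurable_pi_apply i).comp measurable_snd
  refine ⟨hm, ?_⟩
  refine (Measure.pi_eq fun s hs => ?_).symm
  rw [Measure.map_apply hm (MeasurableSet.univ_pi hs)]
  have e : (fun z : ℝ × (ι → ℝ) => Function.update z.2 k z.1) ⁻¹' Set.univ.pi s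
      = s k ×ˢ Set.univ.pi (Function.update s k Set.univ) := by
    ext ⟨t, x⟩
    simp only [Set.mem_preimage, Set.mem_pi, Set.mem_univ, true_implies, Set.mem_prod]
    constructor
    · intro h
      refine ⟨by simpa using h k, fun i => ?_⟩
      by_cases hi : i = k
      · subst hi; simp
      · simpa [Function.update_of_ne hi] using h i
    · rintro ⟨h1, h2⟩ i
      by_cases hi : i = k
      · subst hi; simpa using h1
      · simpa [Function.update_of_ne hi] using h2 i
  rw [e, Measure.prod_prod, Measure.pi_pi, ← Finset.mul_prod_erase _ _ (Finset.mem_univ k),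
    ← Finset.mul_prod_erase _ (fun i => μ (s i)) (Finset.mem_univ k)]
  simp only [Function.update_self, measure_univ, one_mul]
  congr 1
  refine Finset.prod_congr rfl fun i hi => ?_
  rw [Function.update_of_ne (Finset.ne_of_mem_erase hi)]

/-- The standard Gaussian law on `ι → ℝ`. -/
noncomputable abbrev stdGaussianPi (ι : Type*) [Fintype ι] : Measure (ι → ℝ) :=
  Measure.pi fun _ : ι => gaussianReal 0 1

theorem integrable_eval_stdGaussianPi (k : ι) :
    Integrable (fun x : ι → ℝ => x k) (stdGaussianPi ι) := by
  have h := (memLp_id_gaussianReal (μ := 0) (v := 1) 1).integrable le_rfl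
  exact (measurePreserving_eval (fun _ : ι => gaussianReal 0 1) k).integrable_comp_of_integrable h

/-- Gaussian integration by parts in one coordinate. -/
theorem integral_eval_mul_stdGaussianPi [DecidableEq ι] (k : ι) {F F' : (ι → ℝ) → ℝ} {C C' : ℝ}
    (hF : Continuous F) (hF' : Continuous F')
    (hd : ∀ x t, HasDerivAt (fun t => F (Function.update x k t)) (F' (Function.update x k t)) t)
    (hC : ∀ x, |F x| ≤ C) (hC' : ∀ x, |F' x| ≤ C') :
    ∫ x, x k * F x ∂stdGaussianPi ι = ∫ x, F' x ∂stdGaussianPi ι := by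
  have hmp := measurePreserving_update (gaussianReal 0 1) k
  have i1 : Integrable (fun x : ι → ℝ => x k * F x) (stdGaussianPi ι) :=
    (integrable_eval_stdGaussianPi k).mul_bdd (c := C) hF.aestronglyMeasurable
      (Filter.Eventually.of_forall hC)
  have i2 : Integrable F' (stdGaussianPi ι) :=
    Integrable.of_bound hF'.aestronglyMeasurable C' (Filter.Eventually.of_forall hC')
  unfold stdGaussianPi at *
  rw [← hmp.map_eq] at i1 i2
  have j1 := (integrable_map_measure i1.1 hmp.measurable.aemeasurable).1 i1
  have j2 := (integrable_map_measure i2.1 hmp.measurable.aemeasurable).1 i2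
  rw [← hmp.map_eq, integral_map hmp.measurable.aemeasurable i1.1,
    integral_map hmp.measurable.aemeasurable i2.1]
  refine (integral_prod_symm _ j1).trans (Eq.trans ?_ (integral_prod_symm _ j2).symm)
  refine integral_congr_ae (Filter.Eventually.of_forall fun x => ?_)
  simp only [Function.comp_apply, Function.update_self]
  have hu : Continuous fun t : ℝ => Function.update x k t := continuous_const.update k continuous_id
  exact integral_mul_gaussian (fun t => hd x t) (hF'.comp hu).measurable
    (fun t => hC _) (fun t => hC' _)

end Pi

/-! ### Gaussian decoupling by interpolation in the angle `θ`. -/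

section Interpolation

variable {n ι : Type*} [Fintype ι]

/-- The linear form with coefficients `σ i`. -/
def linForm (σ : n → ι → ℝ) (i : n) (x : ι → ℝ) : ℝ := ∑ k, σ i k * x k

/-- The argument `(z - y sin θ) / cos θ` of the interpolating functions. -/
noncomputable def interpArg (z θ y : ℝ) : ℝ := (z - Real.sin θ * y) / Real.cos θ

/-- A bounded function `w` such that `exp w` is, up to a constant, a Gaussian distribution
function: `w' = ψ` and `ψ' = -xψ - ψ²`. -/
structure IsLogCdf (w ψ : ℝ → ℝ) (K : ℝ) : Prop where
  hw : ∀ x, HasDerivAt w (ψ x) x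
  hψ : ∀ x, HasDerivAt ψ (-(x * ψ x) - ψ x ^ 2) x
  w_le : ∀ x, |w x| ≤ K
  ψ_le : ∀ x, |ψ x| ≤ K
  mul_le : ∀ x, |x * ψ x| ≤ K

theorem IsLogCdf.continuous_w {w ψ : ℝ → ℝ} {K : ℝ} (h : IsLogCdf w ψ K) : Continuous w :=
  continuous_iff_continuousAt.2 fun x => (h.hw x).continuousAt

theorem IsLogCdf.continuous_ψ {w ψ : ℝ → ℝ} {K : ℝ} (h : IsLogCdf w ψ K) : Continuous ψ :=
  continuous_iff_continuousAt.2 fun x => (h.hψ x).continuousAt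

theorem IsLogCdf.nonneg {w ψ : ℝ → ℝ} {K : ℝ} (h : IsLogCdf w ψ K) : 0 ≤ K :=
  (abs_nonneg _).trans (h.w_le 0)

theorem hasDerivAt_interpArg_angle {z θ y : ℝ} (hθ : Real.cos θ ≠ 0) :
    HasDerivAt (fun θ => interpArg z θ y) (-y + interpArg z θ y * Real.tan θ) θ := by
  have h := ((((Real.hasDerivAt_sin θ).mul_const y).const_sub z).div (Real.hasDerivAt_cos θ) hθ)
  refine h.congr_deriv ?_
  rw [interpArg, Real.tan_eq_sin_div_cos]
  field_simp
  ring

theorem linForm_update [DecidableEq ι] (σ : n → ι → ℝ) (i : n) (x : ι → ℝ) (k : ι) (t : ℝ) :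
    linForm σ i (Function.update x k t) = σ i k * t + ∑ l ∈ Finset.univ.erase k, σ i l * x l := by
  rw [linForm, ← Finset.add_sum_erase _ _ (Finset.mem_univ k), Function.update_self]
  congr 1
  refine Finset.sum_congr rfl fun l hl => ?_
  rw [Function.update_of_ne (Finset.ne_of_mem_erase hl)]

@[fun_prop]
theorem continuous_linForm (σ : n → ι → ℝ) (i : n) : Continuous (linForm σ i) := by
  unfold linForm
  fun_prop

theorem continuous_interpArg (z θ : ℝ) : Continuous (interpArg z θ) := by
  unfold interpArg
  fun_prop

theorem integrable_linForm (σ : n → ι → ℝ) (i : n) :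
    Integrable (linForm σ i) (stdGaussianPi ι) := by
  unfold linForm
  exact integrable_finsetSum _ fun k _ => (integrable_eval_stdGaussianPi k).const_mul _

theorem hasDerivAt_interpArg_update [DecidableEq ι] (σ : n → ι → ℝ) (z θ : ℝ)
    (i : n) (x : ι → ℝ) (k : ι) (t : ℝ) :
    HasDerivAt (fun t => interpArg z θ (linForm σ i (Function.update x k t)))
      (-(Real.tan θ * σ i k)) t := by
  simp only [linForm_update, interpArg]
  have h := ((((hasDerivAt_id t).const_mul (σ i k)).add_const
    (∑ l ∈ Finset.univ.erase k, σ i l * x l)).const_mul (Real.sin θ)).const_sub z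
  refine (h.div_const (Real.cos θ)).congr_deriv ?_
  rw [Real.tan_eq_sin_div_cos]
  ring

variable [Fintype n]

/-- The integrand `∏ exp (w (q_i) / p)` of the interpolation. -/
noncomputable def interpProd (σ : n → ι → ℝ) (w : ℝ → ℝ) (p z θ : ℝ) (x : ι → ℝ) : ℝ :=
  Real.exp (p⁻¹ * ∑ i, w (interpArg z θ (linForm σ i x)))

theorem continuous_interpProd {σ : n → ι → ℝ} {w ψ : ℝ → ℝ} {K p z θ : ℝ}
    (h : IsLogCdf w ψ K) : Continuous (interpProd σ w p z θ) := by
  unfold interpProd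
  have h1 := h.continuous_w
  have h2 := continuous_interpArg z θ
  fun_prop

theorem interpProd_pos (σ : n → ι → ℝ) (w : ℝ → ℝ) (p z θ : ℝ) (x : ι → ℝ) :
    0 < interpProd σ w p z θ x := Real.exp_pos _

theorem interpProd_le {σ : n → ι → ℝ} {w ψ : ℝ → ℝ} {K p z θ : ℝ} (hp : 0 < p)
    (h : IsLogCdf w ψ K) (x : ι → ℝ) :
    interpProd σ w p z θ x ≤ Real.exp (p⁻¹ * (Fintype.card n * K)) := by
  unfold interpProd
  gcongr
  calc ∑ i, w (interpArg z θ (linForm σ i x)) ≤ ∑ _i : n, K :=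
        Finset.sum_le_sum fun i _ => (le_abs_self _).trans (h.w_le _)
    _ = _ := by simp

theorem integrable_interpProd {σ : n → ι → ℝ} {w ψ : ℝ → ℝ} {K p z θ : ℝ} (hp : 0 < p)
    (h : IsLogCdf w ψ K) : Integrable (interpProd σ w p z θ) (stdGaussianPi ι) := by
  refine Integrable.of_bound (continuous_interpProd h).aestronglyMeasurable
    (Real.exp (p⁻¹ * (Fintype.card n * K))) (Filter.Eventually.of_forall fun x => ?_)
  rw [Real.norm_eq_abs, abs_of_pos (interpProd_pos _ _ _ _ _ _)]
  exact interpProd_le hp h x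

theorem hasDerivAt_interpProd_update [DecidableEq ι] {σ : n → ι → ℝ} {w ψ : ℝ → ℝ} {K p z θ : ℝ}
    (h : IsLogCdf w ψ K) (x : ι → ℝ) (k : ι) (t : ℝ) :
    HasDerivAt (fun t => interpProd σ w p z θ (Function.update x k t))
      (interpProd σ w p z θ (Function.update x k t) * (p⁻¹ *
        ∑ i, ψ (interpArg z θ (linForm σ i (Function.update x k t))) *
          (-(Real.tan θ * σ i k)))) t := by
  unfold interpProd
  refine HasDerivAt.exp (HasDerivAt.const_mul _ (HasDerivAt.fun_sum fun i _ => ?_))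
  exact (h.hw _).comp t (hasDerivAt_interpArg_update σ z θ i x k t)

theorem hasDerivAt_interpProd_angle {σ : n → ι → ℝ} {w ψ : ℝ → ℝ} {K p z θ : ℝ}
    (h : IsLogCdf w ψ K) (hθ : Real.cos θ ≠ 0) (x : ι → ℝ) :
    HasDerivAt (fun θ => interpProd σ w p z θ x)
      (interpProd σ w p z θ x * (p⁻¹ * ∑ i, ψ (interpArg z θ (linForm σ i x)) *
        (-(linForm σ i x) + interpArg z θ (linForm σ i x) * Real.tan θ))) θ := by
  unfold interpProd
  refine HasDerivAt.exp (HasDerivAt.const_mul _ (HasDerivAt.fun_sum fun i _ => ?_))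
  exact HasDerivAt.comp (h₂ := w) θ (h.hw _) (hasDerivAt_interpArg_angle hθ)

/-- The partial derivative along the `k`-th coordinate of `ψ (q_i) ∏ exp (w (q_j) / p)`. -/
noncomputable def interpPartial (σ : n → ι → ℝ) (w ψ : ℝ → ℝ) (p z θ : ℝ) (i : n) (k : ι)
    (x : ι → ℝ) : ℝ :=
  ((-(interpArg z θ (linForm σ i x) * ψ (interpArg z θ (linForm σ i x)))
      - ψ (interpArg z θ (linForm σ i x)) ^ 2) * (-(Real.tan θ * σ i k))) * interpProd σ w p z θ x
    + ψ (interpArg z θ (linForm σ i x)) * (interpProd σ w p z θ x * (p⁻¹ *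
        ∑ j, ψ (interpArg z θ (linForm σ j x)) * (-(Real.tan θ * σ j k))))

theorem continuous_interpPartial {σ : n → ι → ℝ} {w ψ : ℝ → ℝ} {K p z θ : ℝ}
    (h : IsLogCdf w ψ K) (i : n) (k : ι) : Continuous (interpPartial σ w ψ p z θ i k) := by
  have h1 := continuous_interpProd (σ := σ) (p := p) (z := z) (θ := θ) h
  have h2 := h.continuous_ψ
  have h3 := continuous_interpArg z θ
  unfold interpPartial
  fun_prop

theorem exists_abs_interpPartial_le {σ : n → ι → ℝ} {w ψ : ℝ → ℝ} {K p z θ : ℝ} (hp : 0 < p)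
    (h : IsLogCdf w ψ K) (i : n) (k : ι) :
    ∃ C, ∀ x, |interpPartial σ w ψ p z θ i k x| ≤ C := by
  have hK := h.nonneg
  refine ⟨((K + K ^ 2) * (|Real.tan θ * σ i k|)) * Real.exp (p⁻¹ * (Fintype.card n * K))
    + K * (Real.exp (p⁻¹ * (Fintype.card n * K)) * (p⁻¹ *
        ∑ j, K * |Real.tan θ * σ j k|)), fun x => ?_⟩
  have hH : |interpProd σ w p z θ x| ≤ Real.exp (p⁻¹ * (Fintype.card n * K)) := by
    rw [abs_of_pos (interpProd_pos _ _ _ _ _ _)]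
    exact interpProd_le hp h x
  unfold interpPartial
  refine (abs_add_le _ _).trans (add_le_add ?_ ?_)
  · rw [abs_mul, abs_mul, abs_neg]
    gcongr
    refine (abs_sub _ _).trans ?_
    rw [abs_neg, abs_pow]
    gcongr
    · exact h.mul_le _
    · exact h.ψ_le _
  · rw [abs_mul, abs_mul, abs_mul, abs_of_pos (inv_pos.2 hp)]
    gcongr
    · exact h.ψ_le _
    · refine (Finset.abs_sum_le_sum_abs _ _).trans (Finset.sum_le_sum fun j _ => ?_)
      rw [abs_mul, abs_neg]
      gcongr
      exact h.ψ_le _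

/-- Integration by parts for `ψ (q_i) ∏ exp (w (q_j) / p)`. -/
theorem integral_linForm_mul {σ : n → ι → ℝ} {w ψ : ℝ → ℝ} {K p z θ : ℝ} (hp : 0 < p)
    (h : IsLogCdf w ψ K) (i : n) :
    Integrable (fun x => linForm σ i x * (ψ (interpArg z θ (linForm σ i x)) *
        interpProd σ w p z θ x)) (stdGaussianPi ι) ∧
    Integrable (fun x => ∑ k, σ i k * interpPartial σ w ψ p z θ i k x) (stdGaussianPi ι) ∧
    ∫ x, linForm σ i x * (ψ (interpArg z θ (linForm σ i x)) * interpProd σ w p z θ x)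
      ∂stdGaussianPi ι = ∫ x, ∑ k, σ i k * interpPartial σ w ψ p z θ i k x ∂stdGaussianPi ι := by
  classical
  have hK := h.nonneg
  have hF : Continuous fun x => ψ (interpArg z θ (linForm σ i x)) * interpProd σ w p z θ x := by
    have h1 := continuous_interpProd (σ := σ) (p := p) (z := z) (θ := θ) h
    have h2 := h.continuous_ψ
    have h3 := continuous_interpArg z θ
    fun_prop
  have hC : ∀ x, |ψ (interpArg z θ (linForm σ i x)) * interpProd σ w p z θ x| ≤
      K * Real.exp (p⁻¹ * (Fintype.card n * K)) := fun x => by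
    rw [abs_mul, abs_of_pos (interpProd_pos _ _ _ _ _ _)]
    exact mul_le_mul (h.ψ_le _) (interpProd_le hp h x) (interpProd_pos _ _ _ _ _ _).le hK
  have i1 : ∀ k, Integrable (fun x : ι → ℝ => x k * (ψ (interpArg z θ (linForm σ i x)) *
      interpProd σ w p z θ x)) (stdGaussianPi ι) := fun k =>
    (integrable_eval_stdGaussianPi k).mul_bdd hF.aestronglyMeasurable
      (Filter.Eventually.of_forall hC)
  have i2 : ∀ k, Integrable (fun x => interpPartial σ w ψ p z θ i k x) (stdGaussianPi ι) :=
    fun k => by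
    obtain ⟨C, hC⟩ := exists_abs_interpPartial_le (σ := σ) (z := z) (θ := θ) hp h i k
    exact Integrable.of_bound (continuous_interpPartial h i k).aestronglyMeasurable C
      (Filter.Eventually.of_forall hC)
  have e : (fun x => linForm σ i x * (ψ (interpArg z θ (linForm σ i x)) * interpProd σ w p z θ x))
      = fun x => ∑ k, σ i k * (x k * (ψ (interpArg z θ (linForm σ i x)) *
        interpProd σ w p z θ x)) := by
    funext x
    rw [linForm, Finset.sum_mul]
    exact Finset.sum_congr rfl fun k _ => by ring
  refine ⟨?_, integrable_finsetSum _ fun k _ => (i2 k).const_mul _, ?_⟩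
  · rw [e]
    exact integrable_finsetSum _ fun k _ => (i1 k).const_mul _
  · rw [e, integral_finsetSum _ fun k _ => (i1 k).const_mul _,
      integral_finsetSum _ fun k _ => (i2 k).const_mul _]
    refine Finset.sum_congr rfl fun k _ => ?_
    rw [integral_const_mul, integral_const_mul]
    congr 1
    obtain ⟨C, hC'⟩ := exists_abs_interpPartial_le (σ := σ) (z := z) (θ := θ) hp h i k
    refine integral_eval_mul_stdGaussianPi k hF (continuous_interpPartial h i k)
      (fun x t => ?_) hC hC'
    exact (HasDerivAt.comp (h₂ := ψ) t (h.hψ _) (hasDerivAt_interpArg_update σ z θ i x k t)).mul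
      (hasDerivAt_interpProd_update h x k t)

/-- Differentiating `ψ(q_i)` produces `qψ + ψ²`, with coefficient `∑ σ_ik² = 1`; differentiating the
product produces the quadratic form of the covariance, written as a sum of squares over `k`. The
`qψ` term cancels the part of the `θ`-derivative coming from `q tan θ`. -/
theorem sum_interpPartial {σ : n → ι → ℝ} {w ψ : ℝ → ℝ} {p z θ : ℝ}
    (hσ : ∀ i, ∑ k, σ i k ^ 2 = 1) (x : ι → ℝ) :
    ∑ i, ∑ k, σ i k * interpPartial σ w ψ p z θ i k x =
      Real.tan θ * interpProd σ w p z θ x *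
        (∑ i, interpArg z θ (linForm σ i x) * ψ (interpArg z θ (linForm σ i x))
          + ∑ i, ψ (interpArg z θ (linForm σ i x)) ^ 2
          - p⁻¹ * ∑ k, (∑ i, ψ (interpArg z θ (linForm σ i x)) * σ i k) ^ 2) := by
  set H := interpProd σ w p z θ x
  set q := fun i => interpArg z θ (linForm σ i x)
  have e1 : ∀ i, ∑ k, σ i k * interpPartial σ w ψ p z θ i k x =
      Real.tan θ * H * (q i * ψ (q i) + ψ (q i) ^ 2)
      - Real.tan θ * H * p⁻¹ * ∑ k, (ψ (q i) * σ i k) * ∑ j, ψ (q j) * σ j k := fun i => by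
    have e2 : ∀ k, σ i k * interpPartial σ w ψ p z θ i k x =
        Real.tan θ * H * (q i * ψ (q i) + ψ (q i) ^ 2) * σ i k ^ 2
        - Real.tan θ * H * p⁻¹ * ((ψ (q i) * σ i k) * ∑ j, ψ (q j) * σ j k) := fun k => by
      have e3 : ∑ j, ψ (q j) * (-(Real.tan θ * σ j k)) = -Real.tan θ * ∑ j, ψ (q j) * σ j k := by
        rw [Finset.mul_sum]
        exact Finset.sum_congr rfl fun j _ => by ring
      simp only [interpPartial]
      change σ i k * (((-(q i * ψ (q i)) - ψ (q i) ^ 2) * (-(Real.tan θ * σ i k))) * H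
        + ψ (q i) * (H * (p⁻¹ * ∑ j, ψ (q j) * (-(Real.tan θ * σ j k))))) = _
      rw [e3]
      ring
    rw [Finset.sum_congr rfl fun k _ => e2 k, Finset.sum_sub_distrib, ← Finset.mul_sum,
      ← Finset.mul_sum, hσ i, mul_one]
  rw [Finset.sum_congr rfl fun i _ => e1 i, Finset.sum_sub_distrib, ← Finset.mul_sum,
    ← Finset.mul_sum, Finset.sum_comm, Finset.sum_add_distrib]
  have e4 : ∀ k, ∑ i, (ψ (q i) * σ i k) * ∑ j, ψ (q j) * σ j k
      = (∑ j, ψ (q j) * σ j k) ^ 2 := fun k => by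
    rw [← Finset.sum_mul, sq]
  rw [Finset.sum_congr rfl fun k _ => e4 k]
  ring

/-- The interpolated expectation has a nonpositive derivative. -/
theorem exists_hasDerivAt_integral_interpProd {σ : n → ι → ℝ} {w ψ : ℝ → ℝ} {K p z θ : ℝ}
    (hp : 0 < p) (h : IsLogCdf w ψ K) (hσ : ∀ i, ∑ k, σ i k ^ 2 = 1)
    (hR : ∀ v : n → ℝ, ∑ k, (∑ i, v i * σ i k) ^ 2 ≤ p * ∑ i, v i ^ 2)
    (hθ0 : 0 ≤ θ) (hθ : θ < Real.pi / 2) :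
    ∃ D ≤ 0, HasDerivAt (fun θ => ∫ x, interpProd σ w p z θ x ∂stdGaussianPi ι) D θ := by
  have hK := h.nonneg
  have hcos : 0 < Real.cos θ := Real.cos_pos_of_mem_Ioo ⟨by linarith [Real.pi_pos], hθ⟩
  have htan : 0 ≤ Real.tan θ := Real.tan_nonneg_of_nonneg_of_le_pi_div_two hθ0 hθ.le
  -- Near `θ` the tangent is bounded and the cosine positive, which gives an integrable bound,
  -- affine in the `|X_i|`, for differentiating under the integral.
  have hs1 : ∀ᶠ t in nhds θ, |Real.tan t| < |Real.tan θ| + 1 :=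
    ((Real.continuousAt_tan.2 hcos.ne').abs).eventually (gt_mem_nhds (lt_add_one _))
  have hs2 : ∀ᶠ t in nhds θ, 0 < Real.cos t :=
    Real.continuous_cos.continuousAt.eventually (lt_mem_nhds hcos)
  set M := |Real.tan θ| + 1
  set E := Real.exp (p⁻¹ * (Fintype.card n * K))
  have hcont : ∀ t, Continuous (interpProd σ w p z t) := fun t => continuous_interpProd h
  obtain ⟨hi, hd⟩ := hasDerivAt_integral_of_dominated_loc_of_deriv_le
    (μ := stdGaussianPi ι) (F := fun θ x => interpProd σ w p z θ x) (x₀ := θ)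
    (F' := fun θ x => interpProd σ w p z θ x * (p⁻¹ * ∑ i, ψ (interpArg z θ (linForm σ i x)) *
        (-(linForm σ i x) + interpArg z θ (linForm σ i x) * Real.tan θ)))
    (bound := fun x => E * (p⁻¹ * ∑ i, (K * |linForm σ i x| + K * M)))
    (hs1.and hs2) (Filter.Eventually.of_forall fun t => (hcont t).aestronglyMeasurable)
    (integrable_interpProd hp h)
    (by
      have h1 := hcont θ
      have h2 := h.continuous_ψ
      have h3 := continuous_interpArg z θ
      exact Continuous.aestronglyMeasurable (by fun_prop))
    (Filter.Eventually.of_forall fun x t ht => by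
      rw [Real.norm_eq_abs, abs_mul, abs_mul, abs_of_pos (interpProd_pos _ _ _ _ _ _),
        abs_of_pos (inv_pos.2 hp)]
      gcongr
      · exact interpProd_le hp h x
      · refine (Finset.abs_sum_le_sum_abs _ _).trans (Finset.sum_le_sum fun i _ => ?_)
        rw [mul_add]
        refine (abs_add_le _ _).trans (add_le_add ?_ ?_)
        · rw [abs_mul, abs_neg]
          gcongr
          exact h.ψ_le _
        · rw [← mul_assoc, abs_mul, mul_comm (ψ _)]
          gcongr
          · exact h.mul_le _
          · exact ht.1.le)
    (((integrable_finsetSum _ fun i _ => (((integrable_linForm σ i).abs.const_mul K).add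
      (integrable_const _))).const_mul _).const_mul _)
    (Filter.Eventually.of_forall fun x t ht => hasDerivAt_interpProd_angle h ht.2.ne' x)
  refine ⟨_, ?_, hd⟩
  have hparts := fun i => integral_linForm_mul (σ := σ) (z := z) (θ := θ) hp h i
  have hq : ∀ i, Integrable (fun x => interpArg z θ (linForm σ i x) *
      ψ (interpArg z θ (linForm σ i x)) * interpProd σ w p z θ x) (stdGaussianPi ι) := fun i => by
    have h1 := hcont θ
    have h2 := h.continuous_ψ
    have h3 := continuous_interpArg z θ
    refine Integrable.of_bound (Continuous.aestronglyMeasurable (by fun_prop)) (K * E)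
      (Filter.Eventually.of_forall fun x => ?_)
    rw [Real.norm_eq_abs, abs_mul, abs_of_pos (interpProd_pos _ _ _ _ _ _)]
    exact mul_le_mul (h.mul_le _) (interpProd_le hp h x) (interpProd_pos _ _ _ _ _ _).le hK
  have e1 : (∫ x, interpProd σ w p z θ x * (p⁻¹ * ∑ i, ψ (interpArg z θ (linForm σ i x)) *
        (-(linForm σ i x) + interpArg z θ (linForm σ i x) * Real.tan θ)) ∂stdGaussianPi ι)
      = p⁻¹ * (Real.tan θ * ∫ x, ∑ i, interpArg z θ (linForm σ i x) *
          ψ (interpArg z θ (linForm σ i x)) * interpProd σ w p z θ x ∂stdGaussianPi ι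
        - ∫ x, ∑ i, linForm σ i x * (ψ (interpArg z θ (linForm σ i x)) *
          interpProd σ w p z θ x) ∂stdGaussianPi ι) := by
    rw [← integral_const_mul, ← integral_sub ((integrable_finsetSum _ fun i _ => hq i).const_mul _)
      (integrable_finsetSum _ fun i _ => (hparts i).1), ← integral_const_mul]
    refine integral_congr_ae (Filter.Eventually.of_forall fun x => ?_)
    simp only
    rw [mul_left_comm]
    congr 1
    rw [Finset.mul_sum, Finset.mul_sum, ← Finset.sum_sub_distrib]
    exact Finset.sum_congr rfl fun i _ => by ring
  have e2 : ∫ x, ∑ i, linForm σ i x * (ψ (interpArg z θ (linForm σ i x)) *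
          interpProd σ w p z θ x) ∂stdGaussianPi ι
      = ∫ x, ∑ i, ∑ k, σ i k * interpPartial σ w ψ p z θ i k x ∂stdGaussianPi ι := by
    rw [integral_finsetSum _ fun i _ => (hparts i).1,
      integral_finsetSum _ fun i _ => (hparts i).2.1]
    exact Finset.sum_congr rfl fun i _ => (hparts i).2.2
  rw [e1, e2, ← integral_const_mul]
  refine mul_nonpos_of_nonneg_of_nonpos (inv_pos.2 hp).le (sub_nonpos.2 ?_)
  refine integral_mono ((integrable_finsetSum _ fun i _ => hq i).const_mul _)
    (integrable_finsetSum _ fun i _ => (hparts i).2.1) fun x => ?_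
  simp only
  rw [sum_interpPartial hσ, ← Finset.sum_mul]
  have hR' := hR fun i => ψ (interpArg z θ (linForm σ i x))
  -- The only use of the covariance bound, applied to the vector `ψ(q_i)`; the exponent `1/p` is
  -- what makes it suffice.
  have h5 : 0 ≤ ∑ i, ψ (interpArg z θ (linForm σ i x)) ^ 2
      - p⁻¹ * ∑ k, (∑ i, ψ (interpArg z θ (linForm σ i x)) * σ i k) ^ 2 := by
    rw [sub_nonneg, inv_mul_le_iff₀ hp]
    exact hR'
  have h6 := mul_nonneg (mul_nonneg htan (interpProd_pos σ w p z θ x).le) h5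
  rw [add_sub_assoc, mul_add, ← mul_assoc, mul_right_comm]
  exact le_add_of_nonneg_right h6

theorem integral_interpProd_le {σ : n → ι → ℝ} {w ψ : ℝ → ℝ} {K p z θ : ℝ}
    (hp : 0 < p) (h : IsLogCdf w ψ K) (hσ : ∀ i, ∑ k, σ i k ^ 2 = 1)
    (hR : ∀ v : n → ℝ, ∑ k, (∑ i, v i * σ i k) ^ 2 ≤ p * ∑ i, v i ^ 2)
    (hθ0 : 0 ≤ θ) (hθ : θ < Real.pi / 2) :
    ∫ x, interpProd σ w p z θ x ∂stdGaussianPi ι ≤ Real.exp (p⁻¹ * (Fintype.card n * w z)) := by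
  have hder : ∀ t ∈ Set.Icc 0 θ, ∃ D ≤ 0,
      HasDerivAt (fun θ => ∫ x, interpProd σ w p z θ x ∂stdGaussianPi ι) D t := fun t ht =>
    exists_hasDerivAt_integral_interpProd hp h hσ hR ht.1 (ht.2.trans_lt hθ)
  have hanti : AntitoneOn (fun θ => ∫ x, interpProd σ w p z θ x ∂stdGaussianPi ι)
      (Set.Icc 0 θ) := by
    refine antitoneOn_of_deriv_nonpos (convex_Icc _ _) (fun t ht => ?_) (fun t ht => ?_)
      fun t ht => ?_
    · obtain ⟨D, _, hD⟩ := hder t ht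
      exact hD.continuousAt.continuousWithinAt
    · obtain ⟨D, _, hD⟩ := hder t (interior_subset ht)
      exact hD.differentiableAt.differentiableWithinAt
    · obtain ⟨D, hD0, hD⟩ := hder t (interior_subset ht)
      rwa [hD.deriv]
  -- At `θ = 0` every argument equals `z`, so the integrand is constant.
  refine (hanti (Set.left_mem_Icc.2 hθ0) (Set.right_mem_Icc.2 hθ0) hθ0).trans (le_of_eq ?_)
  simp [interpProd, interpArg]

/-- The shift by `κ` keeps the logarithm and its derivative bounded where `Φ` tends to 0; since `κ`
is constant, the differential equation for `ψ` is the same as without it. -/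
theorem isLogCdf_log {κ : ℝ} (hκ : 0 < κ) (hκ1 : κ < 1) :
    IsLogCdf (fun x => Real.log (κ + stdCdf x)) (fun x => stdPdf x / (κ + stdCdf x))
      (max (-Real.log κ) κ⁻¹ + 1) := by
  have hpos : ∀ x, 0 < κ + stdCdf x := fun x => by linarith [stdCdf_nonneg x]
  have hinv : ∀ x, (κ + stdCdf x)⁻¹ ≤ κ⁻¹ := fun x =>
    inv_anti₀ hκ (by linarith [stdCdf_nonneg x])
  have hd : ∀ x, HasDerivAt (fun x => κ + stdCdf x) (stdPdf x) x := fun x =>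
    (hasDerivAt_stdCdf x).const_add κ
  have hbd : κ⁻¹ ≤ max (-Real.log κ) κ⁻¹ + 1 := (le_max_right _ _).trans (by linarith)
  refine ⟨fun x => (hd x).log (hpos x).ne', fun x => ?_, fun x => ?_, fun x => ?_, fun x => ?_⟩
  · refine ((hasDerivAt_stdPdf x).div (hd x) (hpos x).ne').congr_deriv ?_
    have := (hpos x).ne'
    field_simp
  · rw [abs_le]
    have h1 : Real.log κ ≤ Real.log (κ + stdCdf x) :=
      Real.log_le_log hκ (by linarith [stdCdf_nonneg x])
    have h2 : Real.log (κ + stdCdf x) ≤ κ + stdCdf x - 1 :=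
      Real.log_le_sub_one_of_pos (hpos x)
    have h3 : κ⁻¹ > 0 := inv_pos.2 hκ
    have h4 := le_max_left (-Real.log κ) κ⁻¹
    have h5 := le_max_right (-Real.log κ) κ⁻¹
    have h6 := stdCdf_le_one x
    generalize max (-Real.log κ) κ⁻¹ = m at h4 h5 ⊢
    generalize κ⁻¹ = c at h3 h5
    constructor <;> linarith
  · rw [abs_of_nonneg (div_nonneg (stdPdf_nonneg x) (hpos x).le), div_eq_mul_inv]
    calc _ ≤ 1 * κ⁻¹ := by
          exact mul_le_mul (stdPdf_le_one x) (hinv x) (inv_pos.2 (hpos x)).le zero_le_one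
      _ ≤ _ := by rwa [one_mul]
  · rw [← mul_div_assoc, abs_div, abs_of_pos (hpos x), div_eq_mul_inv]
    calc _ ≤ 1 * κ⁻¹ := by
          exact mul_le_mul (abs_mul_stdPdf_le_one x) (hinv x) (inv_pos.2 (hpos x)).le zero_le_one
      _ ≤ _ := by rwa [one_mul]

theorem exp_mul_log_eq_rpow {a b : ℝ} (ha : 0 < a) : Real.exp (b * Real.log a) = a ^ b := by
  rw [Real.rpow_def_of_pos ha, mul_comm]

theorem measurableSet_linForm_le (σ : n → ι → ℝ) (z : ℝ) :
    MeasurableSet {x : ι → ℝ | ∀ i, linForm σ i x ≤ z} := by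
  rw [Set.ofPred_forall]
  exact MeasurableSet.iInter fun i =>
    measurableSet_le (continuous_linForm σ i).measurable measurable_const

open Filter Topology in
/-- **Gaussian decoupling**: if `X_i` are centred jointly Gaussian variables of unit variance
whose covariance matrix is at most `p` times the identity, then
`P (∀ i, X_i ≤ z) ≤ P (N ≤ z) ^ (n / p)`. -/
theorem measureReal_forall_linForm_le {σ : n → ι → ℝ} {p z : ℝ}
    (hp : 0 < p) (hσ : ∀ i, ∑ k, σ i k ^ 2 = 1)
    (hR : ∀ v : n → ℝ, ∑ k, (∑ i, v i * σ i k) ^ 2 ≤ p * ∑ i, v i ^ 2) (hz : 0 ≤ z) :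
    (stdGaussianPi ι).real {x | ∀ i, linForm σ i x ≤ z} ≤
      stdCdf z ^ (p⁻¹ * Fintype.card n) := by
  set S := {x : ι → ℝ | ∀ i, linForm σ i x ≤ z}
  have hS : MeasurableSet S := measurableSet_linForm_le σ z
  set e := p⁻¹ * (Fintype.card n : ℝ)
  have he : 0 ≤ e := by positivity
  -- On the event, `X_i sin θ ≤ z` because `z ≥ 0`, so each argument is at least `(z₁ - z) / cos θ`;
  -- the expectation is then bounded below by restricting to the event.
  have step1 : ∀ z₁ κ θ : ℝ, 0 < κ → κ < 1 → 0 ≤ θ → θ < Real.pi / 2 →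
      (stdGaussianPi ι).real S * (κ + stdCdf ((z₁ - z) / Real.cos θ)) ^ e ≤
        (κ + stdCdf z₁) ^ e := by
    intro z₁ κ θ hκ hκ1 hθ0 hθ
    have hcos : 0 < Real.cos θ := Real.cos_pos_of_mem_Ioo ⟨by linarith [Real.pi_pos], hθ⟩
    have hpos : ∀ x, 0 < κ + stdCdf x := fun x => by linarith [stdCdf_nonneg x]
    have hw := isLogCdf_log hκ hκ1
    have h := integral_interpProd_le (z := z₁) hp hw hσ hR hθ0 hθ
    rw [← mul_assoc, exp_mul_log_eq_rpow (hpos z₁)] at h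
    refine le_trans ?_ h
    have hint := integrable_interpProd (σ := σ) (z := z₁) (θ := θ) hp hw
    refine le_trans ?_ (setIntegral_le_integral (s := S) hint
      (Eventually.of_forall fun x => (interpProd_pos _ _ _ _ _ _).le))
    have h2 := setIntegral_mono_on (μ := stdGaussianPi ι) (s := S)
      (f := fun _ => (κ + stdCdf ((z₁ - z) / Real.cos θ)) ^ e)
      (integrable_const _).integrableOn hint.integrableOn hS fun x hx => by
        rw [← exp_mul_log_eq_rpow (hpos _)]
        unfold interpProd
        rw [mul_assoc]
        gcongr
        have h3 : ∑ _i : n, Real.log (κ + stdCdf ((z₁ - z) / Real.cos θ)) ≤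
            ∑ i, Real.log (κ + stdCdf (interpArg z₁ θ (linForm σ i x))) := by
          refine Finset.sum_le_sum fun i _ => Real.log_le_log (hpos _) ?_
          gcongr
          refine monotone_stdCdf ?_
          unfold interpArg
          gcongr
          have hx' : linForm σ i x ≤ z := hx i
          have hs0 : 0 ≤ Real.sin θ :=
            Real.sin_nonneg_of_nonneg_of_le_pi hθ0 (by linarith [Real.pi_pos])
          have hs1 : Real.sin θ ≤ 1 := Real.sin_le_one θ
          nlinarith
        simpa using h3
    rwa [setIntegral_const, smul_eq_mul] at h2
  -- As `θ` increases to `π/2` the quotient tends to infinity; the strict gap `z < z₁` is needed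
  -- here and is closed at the end by continuity, after `κ` tends to 0.
  have step2 : ∀ z₁ κ : ℝ, z < z₁ → 0 < κ → κ < 1 →
      (stdGaussianPi ι).real S * (κ + 1) ^ e ≤ (κ + stdCdf z₁) ^ e := by
    intro z₁ κ hz₁ hκ hκ1
    have hcos : Tendsto Real.cos (𝓝[<] (Real.pi / 2)) (𝓝[>] 0) := by
      refine tendsto_nhdsWithin_iff.2 ⟨?_, ?_⟩
      · have := Real.continuous_cos.tendsto (Real.pi / 2)
        rw [Real.cos_pi_div_two] at this
        exact this.mono_left nhdsWithin_le_nhds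
      · filter_upwards [Ioo_mem_nhdsLT (a := 0) (b := Real.pi / 2) (by positivity)] with t ht
        exact Real.cos_pos_of_mem_Ioo ⟨by linarith [ht.1, Real.pi_pos], ht.2⟩
    have h1 : Tendsto (fun θ => (z₁ - z) / Real.cos θ) (𝓝[<] (Real.pi / 2)) atTop :=
      (tendsto_inv_nhdsGT_zero.comp hcos).const_mul_atTop (sub_pos.2 hz₁)
    have h2 : Tendsto (fun θ => (stdGaussianPi ι).real S *
        (κ + stdCdf ((z₁ - z) / Real.cos θ)) ^ e) (𝓝[<] (Real.pi / 2))
        (𝓝 ((stdGaussianPi ι).real S * (κ + 1) ^ e)) :=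
      (((tendsto_stdCdf_atTop.comp h1).const_add κ).rpow_const (Or.inr he)).const_mul _
    refine le_of_tendsto h2 ?_
    filter_upwards [Ioo_mem_nhdsLT (a := 0) (b := Real.pi / 2) (by positivity)] with t ht
    exact step1 z₁ κ t hκ hκ1 ht.1.le ht.2
  have step3 : ∀ z₁ : ℝ, z < z₁ → (stdGaussianPi ι).real S ≤ stdCdf z₁ ^ e := by
    intro z₁ hz₁
    have h1 : ∀ c : ℝ, Tendsto (fun κ : ℝ => (κ + c) ^ e) (𝓝[>] 0) (𝓝 (c ^ e)) := fun c => by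
      have h : Tendsto (fun κ : ℝ => κ + c) (𝓝 0) (𝓝 (0 + c)) :=
        (continuous_id.add continuous_const).tendsto 0
      rw [zero_add] at h
      exact (h.rpow_const (Or.inr he)).mono_left nhdsWithin_le_nhds
    have h2 := le_of_tendsto_of_tendsto ((h1 1).const_mul ((stdGaussianPi ι).real S))
      (h1 (stdCdf z₁)) (by
        filter_upwards [Ioo_mem_nhdsGT (zero_lt_one' ℝ)] with κ hκ
        exact step2 z₁ κ hz₁ hκ.1 hκ.2)
    simpa using h2
  have h4 : Tendsto (fun z₁ => stdCdf z₁ ^ e) (𝓝[>] z) (𝓝 (stdCdf z ^ e)) :=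
    ((continuous_stdCdf.tendsto z).rpow_const (Or.inr he)).mono_left nhdsWithin_le_nhds
  refine ge_of_tendsto h4 ?_
  filter_upwards [self_mem_nhdsWithin] with z₁ hz₁
  exact step3 z₁ hz₁

end Interpolation

/-! ### Choice of nearly uncorrelated points and Schur's bound. -/

section Points

/-- A point of `[0, ε]` at which the translates of a periodic function are small on average. -/
theorem exists_sum_translate_le {f : ℝ → ℝ} (hf : Continuous f) (hf0 : ∀ t, 0 ≤ f t)
    (hper : Function.Periodic f 1) {ε : ℝ} (hε : 0 < ε) (hε1 : ε ≤ 1) (t : ℕ → ℝ) (m : ℕ) :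
    ∃ s ∈ Set.Icc 0 ε, ∑ j ∈ Finset.range m, f (s - t j) ≤ m * (∫ u in (0 : ℝ)..1, f u) / ε := by
  by_contra! hcon
  set β := ∫ u in (0 : ℝ)..1, f u
  have hi : ∀ a b, IntervalIntegrable f volume a b := fun a b => hf.intervalIntegrable a b
  have h1 : ∫ s in (0 : ℝ)..ε, ∑ j ∈ Finset.range m, f (s - t j) ≤ m * β := by
    have hft : ∀ j, Continuous fun s => f (s - t j) := fun j => by fun_prop
    rw [intervalIntegral.integral_finsetSum fun j _ => (hft j).intervalIntegrable _ _]
    -- As `ε ≤ 1`, the translated interval lies in a single period, and `f ≥ 0`.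
    have h : ∀ j ∈ Finset.range m, ∫ s in (0 : ℝ)..ε, f (s - t j) ≤ β := fun j _ => by
      rw [intervalIntegral.integral_comp_sub_right f (t j)]
      have e : β = ∫ u in (0 - t j)..(0 - t j + 1), f u := by
        rw [hper.intervalIntegral_add_eq (0 - t j) 0, zero_add]
      rw [e]
      exact intervalIntegral.integral_mono_interval le_rfl (by linarith) (by linarith)
        (Filter.Eventually.of_forall hf0) (hi _ _)
    calc _ ≤ ∑ _j ∈ Finset.range m, β := Finset.sum_le_sum h
      _ = m * β := by simp
  have h2 : ∫ _ in (0 : ℝ)..ε, m * β / ε < ∫ s in (0 : ℝ)..ε, ∑ j ∈ Finset.range m, f (s - t j) :=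
    intervalIntegral.integral_lt_integral_of_continuousOn_of_le_of_exists_lt hε
      continuousOn_const (by fun_prop) (fun s hs => (hcon s ⟨hs.1.le, hs.2⟩).le)
      ⟨0, ⟨le_rfl, hε.le⟩, hcon 0 ⟨le_rfl, hε.le⟩⟩
  rw [intervalIntegral.integral_const, sub_zero, smul_eq_mul, mul_div_cancel₀ _ hε.ne'] at h2
  linarith

theorem exists_greedy_points {f : ℝ → ℝ} (hf : Continuous f) (hf0 : ∀ t, 0 ≤ f t)
    (hper : Function.Periodic f 1) {ε : ℝ} (hε : 0 < ε) (hε1 : ε ≤ 1) (N : ℕ) :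
    ∃ t : ℕ → ℝ, ∀ m < N, t m ∈ Set.Icc 0 ε ∧
      ∑ j ∈ Finset.range m, f (t m - t j) ≤ m * (∫ u in (0 : ℝ)..1, f u) / ε := by
  induction N with
  | zero => exact ⟨0, fun m hm => absurd hm (Nat.not_lt_zero m)⟩
  | succ N ih =>
    obtain ⟨t, ht⟩ := ih
    obtain ⟨s, hs, hle⟩ := exists_sum_translate_le hf hf0 hper hε hε1 t N
    have hsum : ∀ m ≤ N, ∀ r : ℝ, ∑ j ∈ Finset.range m, f (r - Function.update t N s j) =
        ∑ j ∈ Finset.range m, f (r - t j) := fun m hm r =>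
      Finset.sum_congr rfl fun j hj => by
        rw [Function.update_of_ne ((Finset.mem_range.1 hj).trans_le hm).ne]
    refine ⟨Function.update t N s, fun m hm => ?_⟩
    rw [hsum m (Nat.lt_succ_iff.1 hm)]
    rcases (Nat.lt_succ_iff.1 hm).lt_or_eq with h | rfl
    · rw [Function.update_of_ne h.ne]
      exact ht m h
    · rw [Function.update_self]
      exact ⟨hs, hle⟩

/-- The greedy choice controls only earlier points. By evenness the two triangles have equal sums,
each at most `N`, and the diagonal contributes at most `N` more. -/
theorem sum_sum_le_three_mul {f : ℝ → ℝ} (heven : ∀ t, f (-t) = f t) (h0 : f 0 ≤ 1) {t : ℕ → ℝ}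
    {N : ℕ} (h : ∀ m < N, ∑ j ∈ Finset.range m, f (t m - t j) ≤ 1) :
    ∑ i ∈ Finset.range N, ∑ j ∈ Finset.range N, f (t i - t j) ≤ 3 * N := by
  induction N with
  | zero => simp
  | succ N ih =>
    have h1 := ih fun m hm => h m (hm.trans (Nat.lt_succ_self N))
    have h2 := h N (Nat.lt_succ_self N)
    have h3 : ∑ i ∈ Finset.range N, f (t i - t N) = ∑ j ∈ Finset.range N, f (t N - t j) :=
      Finset.sum_congr rfl fun i _ => by rw [← heven, neg_sub]
    simp only [Finset.sum_range_succ, Finset.sum_add_distrib, sub_self]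
    rw [h3]
    push_cast
    linarith

/-- At least half of the rows of a nonnegative matrix with total sum `≤ 3N` have sum `≤ 6`. -/
theorem card_le_two_mul_card_filter {N : ℕ} {r : ℕ → ℝ} (hr : ∀ i, 0 ≤ r i)
    (h : ∑ i ∈ Finset.range N, r i ≤ 3 * N) :
    (N : ℝ) ≤ 2 * ((Finset.range N).filter fun i => r i ≤ 6).card := by
  have h1 := Finset.sum_filter_add_sum_filter_not (Finset.range N) (fun i => r i ≤ 6) r
  have h2 : 0 ≤ ∑ i ∈ Finset.range N with r i ≤ 6, r i := Finset.sum_nonneg fun i _ => hr i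
  have h3 : ((Finset.range N).filter fun i => ¬ r i ≤ 6).card • (6 : ℝ) ≤
      ∑ i ∈ Finset.range N with ¬ r i ≤ 6, r i :=
    Finset.card_nsmul_le_sum _ _ _ fun i hi => (not_le.1 (Finset.mem_filter.1 hi).2).le
  have h4 := Finset.card_filter_add_card_filter_not (s := Finset.range N) (fun i => r i ≤ 6)
  rw [Finset.card_range] at h4
  rw [nsmul_eq_mul] at h3
  have h5 : (((Finset.range N).filter fun i => r i ≤ 6).card : ℝ) +
      ((Finset.range N).filter fun i => ¬ r i ≤ 6).card = N := by exact_mod_cast h4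
  linarith

/-- Schur's bound of a quadratic form by the row sums. -/
theorem sum_sum_mul_le_of_row_sum_le {n : Type*} [Fintype n] {R : n → n → ℝ} {p : ℝ}
    (hsymm : ∀ i j, R i j = R j i) (hrow : ∀ i, ∑ j, |R i j| ≤ p) (v : n → ℝ) :
    ∑ i, ∑ j, v i * v j * R i j ≤ p * ∑ i, v i ^ 2 := by
  have h1 : ∀ i j, v i * v j * R i j ≤ (v i ^ 2 * |R i j|) / 2 + (v j ^ 2 * |R j i|) / 2 :=
    fun i j => by
    rw [← hsymm i j]
    have h2 : v i * v j * R i j ≤ |v i| * |v j| * |R i j| := by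
      rw [← abs_mul, ← abs_mul]; exact le_abs_self _
    have h3 : |v i| * |v j| ≤ (v i ^ 2 + v j ^ 2) / 2 := by
      nlinarith [sq_nonneg (|v i| - |v j|), sq_abs (v i), sq_abs (v j)]
    nlinarith [mul_le_mul_of_nonneg_right h3 (abs_nonneg (R i j))]
  calc ∑ i, ∑ j, v i * v j * R i j
      ≤ ∑ i, ∑ j, ((v i ^ 2 * |R i j|) / 2 + (v j ^ 2 * |R j i|) / 2) :=
        Finset.sum_le_sum fun i _ => Finset.sum_le_sum fun j _ => h1 i j
    _ = ∑ i, v i ^ 2 * ∑ j, |R i j| := by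
        simp only [Finset.sum_add_distrib]
        rw [Finset.sum_comm (f := fun i j => v j ^ 2 * |R j i| / 2), ← Finset.sum_add_distrib]
        refine Finset.sum_congr rfl fun i _ => ?_
        rw [← Finset.sum_add_distrib, Finset.mul_sum]
        exact Finset.sum_congr rfl fun j _ => by ring
    _ ≤ ∑ i, v i ^ 2 * p := Finset.sum_le_sum fun i _ =>
        mul_le_mul_of_nonneg_left (hrow i) (sq_nonneg _)
    _ = p * ∑ i, v i ^ 2 := by rw [← Finset.sum_mul, mul_comm]

end Points

/-! ### Mean size of the covariance function. -/

section Covariance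

/-- The covariance function `∑ a_k² cos (2π j_k t)`. -/
noncomputable def trigCov (W : Finset ℕ) (a : ℕ → ℝ) (j : ℕ → ℤ) (t : ℝ) : ℝ :=
  ∑ k ∈ W, a k ^ 2 * Real.cos (2 * Real.pi * j k * t)

@[fun_prop]
theorem continuous_trigCov (W : Finset ℕ) (a : ℕ → ℝ) (j : ℕ → ℤ) :
    Continuous (trigCov W a j) := by
  unfold trigCov
  fun_prop

theorem trigCov_zero (W : Finset ℕ) (a : ℕ → ℝ) (j : ℕ → ℤ) :
    trigCov W a j 0 = ∑ k ∈ W, a k ^ 2 := by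
  simp [trigCov]

theorem trigCov_neg (W : Finset ℕ) (a : ℕ → ℝ) (j : ℕ → ℤ) (t : ℝ) :
    trigCov W a j (-t) = trigCov W a j t := by
  simp [trigCov]

theorem periodic_trigCov (W : Finset ℕ) (a : ℕ → ℝ) (j : ℕ → ℤ) :
    Function.Periodic (trigCov W a j) 1 := fun t => by
  unfold trigCov
  refine Finset.sum_congr rfl fun k _ => ?_
  rw [show 2 * Real.pi * j k * (t + 1) = 2 * Real.pi * j k * t + j k * (2 * Real.pi) by ring,
    Real.cos_add_int_mul_two_pi]

theorem integral_cos_two_pi_int_mul (m : ℤ) :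
    ∫ t in (0 : ℝ)..1, Real.cos (2 * Real.pi * m * t) = if m = 0 then 1 else 0 := by
  split_ifs with h
  · simp [h]
  · have hc : 2 * Real.pi * (m : ℝ) ≠ 0 := by
      have : (m : ℝ) ≠ 0 := by exact_mod_cast h
      positivity
    rw [intervalIntegral.integral_comp_mul_left _ hc, integral_cos, mul_zero, mul_one, Real.sin_zero,
      sub_zero, show 2 * Real.pi * (m : ℝ) = ((2 * m : ℤ) : ℝ) * Real.pi by push_cast; ring,
      Real.sin_int_mul_pi, smul_zero]

theorem integral_cos_mul_cos (m l : ℤ) :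
    ∫ t in (0 : ℝ)..1, Real.cos (2 * Real.pi * m * t) * Real.cos (2 * Real.pi * l * t) =
      ((if m = l then 1 else 0) + if m = -l then 1 else 0) / 2 := by
  have e : ∀ t : ℝ, Real.cos (2 * Real.pi * m * t) * Real.cos (2 * Real.pi * l * t) =
      (Real.cos (2 * Real.pi * (m - l : ℤ) * t) + Real.cos (2 * Real.pi * (m + l : ℤ) * t)) / 2 :=
    fun t => by
    have h1 : 2 * Real.pi * ((m - l : ℤ) : ℝ) * t =
        2 * Real.pi * m * t - 2 * Real.pi * l * t := by push_cast; ring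
    have h2 : 2 * Real.pi * ((m + l : ℤ) : ℝ) * t =
        2 * Real.pi * m * t + 2 * Real.pi * l * t := by push_cast; ring
    rw [h1, h2, Real.cos_sub, Real.cos_add]
    ring
  simp only [e]
  rw [intervalIntegral.integral_div, intervalIntegral.integral_add
    (Continuous.intervalIntegrable (by fun_prop) _ _)
    (Continuous.intervalIntegrable (by fun_prop) _ _), integral_cos_two_pi_int_mul,
    integral_cos_two_pi_int_mul]
  simp only [sub_eq_zero, add_eq_zero_iff_eq_neg]

/-- If each index is related to at most one index, then the sum of the products over related pairs
is at most the sum of the squares. -/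
theorem sum_sum_ite_mul_le {W : Finset ℕ} {b : ℕ → ℝ} {r : ℕ → ℕ → Prop} [DecidableRel r]
    (hsymm : ∀ k l, r k l → r l k)
    (huniq : ∀ k ∈ W, ∀ l ∈ W, ∀ l' ∈ W, r k l → r k l' → l = l') :
    ∑ k ∈ W, ∑ l ∈ W, b k * b l * (if r k l then 1 else 0) ≤ ∑ k ∈ W, b k ^ 2 := by
  have hone : ∀ k ∈ W, ∑ l ∈ W, (if r k l then (1 : ℝ) else 0) ≤ 1 := fun k hk => by
    rw [Finset.sum_boole]
    have : (W.filter fun l => r k l).card ≤ 1 := Finset.card_le_one.2 fun l hl l' hl' =>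
      huniq k hk l (Finset.mem_filter.1 hl).1 l' (Finset.mem_filter.1 hl').1
        (Finset.mem_filter.1 hl).2 (Finset.mem_filter.1 hl').2
    exact_mod_cast this
  have hs : ∀ k l, (if r k l then (1 : ℝ) else 0) = if r l k then 1 else 0 := fun k l => by
    simp only [show r k l ↔ r l k from ⟨hsymm k l, hsymm l k⟩]
  calc ∑ k ∈ W, ∑ l ∈ W, b k * b l * (if r k l then (1 : ℝ) else 0)
      ≤ ∑ k ∈ W, ∑ l ∈ W, (b k ^ 2 / 2 * (if r k l then (1 : ℝ) else 0) +
          b l ^ 2 / 2 * (if r l k then (1 : ℝ) else 0)) := by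
        refine Finset.sum_le_sum fun k _ => Finset.sum_le_sum fun l _ => ?_
        rw [← hs k l, ← add_mul]
        refine mul_le_mul_of_nonneg_right ?_ (by positivity)
        nlinarith [sq_nonneg (b k - b l)]
    _ = ∑ k ∈ W, b k ^ 2 * ∑ l ∈ W, (if r k l then (1 : ℝ) else 0) := by
        simp only [Finset.sum_add_distrib]
        rw [Finset.sum_comm (f := fun k l => b l ^ 2 / 2 * (if r l k then (1 : ℝ) else 0)),
          ← Finset.sum_add_distrib]
        refine Finset.sum_congr rfl fun k _ => ?_
        rw [← Finset.mul_sum]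
        ring
    _ ≤ ∑ k ∈ W, b k ^ 2 * 1 := Finset.sum_le_sum fun k hk =>
        mul_le_mul_of_nonneg_left (hone k hk) (sq_nonneg _)
    _ = ∑ k ∈ W, b k ^ 2 := by simp

/-- Only pairs with `j_k = ±j_l` survive integration, each sign with weight `1/2`. Frequencies may
be negative, so both signs can occur, but injectivity of `j` allows at most one partner per sign. -/
theorem integral_trigCov_sq_le {W : Finset ℕ} {a : ℕ → ℝ} {j : ℕ → ℤ}
    (hj : Set.InjOn j W) :
    ∫ t in (0 : ℝ)..1, trigCov W a j t ^ 2 ≤ ∑ k ∈ W, a k ^ 4 := by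
  have e : ∀ t, trigCov W a j t ^ 2 = ∑ k ∈ W, ∑ l ∈ W, a k ^ 2 * a l ^ 2 *
      (Real.cos (2 * Real.pi * j k * t) * Real.cos (2 * Real.pi * j l * t)) := fun t => by
    rw [sq, trigCov, Finset.sum_mul_sum]
    exact Finset.sum_congr rfl fun k _ => Finset.sum_congr rfl fun l _ => by ring
  simp only [e]
  rw [intervalIntegral.integral_finsetSum fun k _ =>
    Continuous.intervalIntegrable (by fun_prop) _ _]
  have e2 : ∀ k ∈ W, ∫ t in (0 : ℝ)..1, ∑ l ∈ W, a k ^ 2 * a l ^ 2 *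
      (Real.cos (2 * Real.pi * j k * t) * Real.cos (2 * Real.pi * j l * t)) =
      (∑ l ∈ W, a k ^ 2 * a l ^ 2 * (if j k = j l then 1 else 0)) / 2 +
      (∑ l ∈ W, a k ^ 2 * a l ^ 2 * (if j k = -j l then 1 else 0)) / 2 := fun k _ => by
    rw [intervalIntegral.integral_finsetSum fun l _ =>
      Continuous.intervalIntegrable (by fun_prop) _ _, Finset.sum_div, Finset.sum_div,
      ← Finset.sum_add_distrib]
    refine Finset.sum_congr rfl fun l _ => ?_
    rw [intervalIntegral.integral_const_mul, integral_cos_mul_cos]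
    ring
  rw [Finset.sum_congr rfl e2, Finset.sum_add_distrib, ← Finset.sum_div, ← Finset.sum_div]
  have h1 := sum_sum_ite_mul_le (W := W) (b := fun k => a k ^ 2) (r := fun k l => j k = j l)
    (fun k l h => h.symm) (fun k _ l hl l' hl' h h' => hj hl hl' (h.symm.trans h'))
  have h2 := sum_sum_ite_mul_le (W := W) (b := fun k => a k ^ 2) (r := fun k l => j k = -j l)
    (fun k l h => by omega) (fun k _ l hl l' hl' h h' => hj hl hl' (by omega))
  have h3 : ∑ k ∈ W, (a k ^ 2) ^ 2 = ∑ k ∈ W, a k ^ 4 :=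
    Finset.sum_congr rfl fun k _ => by ring
  rw [h3] at h1 h2
  linarith

theorem integral_abs_trigCov_le {W : Finset ℕ} {a : ℕ → ℝ} {j : ℕ → ℤ} (hj : Set.InjOn j W) :
    ∫ t in (0 : ℝ)..1, |trigCov W a j t| ≤ √(∑ k ∈ W, a k ^ 4) := by
  set β := ∫ t in (0 : ℝ)..1, |trigCov W a j t| with hβ
  apply Real.le_sqrt_of_sq_le
  refine le_trans ?_ (integral_trigCov_sq_le hj)
  have hc := continuous_trigCov W a j
  -- Cauchy–Schwarz in the form of a nonnegative variance over the unit interval.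
  have h0 : 0 ≤ ∫ t in (0 : ℝ)..1, (|trigCov W a j t| - β) ^ 2 :=
    intervalIntegral.integral_nonneg zero_le_one fun t _ => sq_nonneg _
  have e : ∀ t, (|trigCov W a j t| - β) ^ 2 =
      trigCov W a j t ^ 2 - 2 * β * |trigCov W a j t| + β ^ 2 := fun t => by
    rw [← sq_abs (trigCov W a j t)]
    ring
  simp only [e] at h0
  rw [intervalIntegral.integral_add (Continuous.intervalIntegrable (by fun_prop) _ _)
    (Continuous.intervalIntegrable (by fun_prop) _ _),
    intervalIntegral.integral_sub (Continuous.intervalIntegrable (by fun_prop) _ _)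
    (Continuous.intervalIntegrable (by fun_prop) _ _), intervalIntegral.integral_const_mul,
    intervalIntegral.integral_const, ← hβ, sub_zero, one_smul] at h0
  nlinarith

end Covariance

/-! ### Joint law of the Gaussian coefficients. -/

section Law

/-- The coordinates over a finite set of indices have the standard Gaussian law. -/
theorem IsStdGaussianPair.map_eq {Ω : Type*} [MeasurableSpace Ω] {P : Measure Ω}
    [IsProbabilityMeasure P] {g g' : ℕ → Ω → ℝ} (h : IsStdGaussianPair P g g') {W : Finset ℕ}
    (hW : ∀ k ∈ W, 1 ≤ k) :
    AEMeasurable (fun ω (i : W ⊕ W) => Sum.elim (fun k : W => g k ω) (fun k : W => g' k ω) i) P ∧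
    P.map (fun ω (i : W ⊕ W) => Sum.elim (fun k : W => g k ω) (fun k : W => g' k ω) i) =
      stdGaussianPi (W ⊕ W) := by
  have hlaw : ∀ i : W ⊕ W, HasLaw
      (fun ω => Sum.elim (fun k : W => g k ω) (fun k : W => g' k ω) i) (gaussianReal 0 1) P := by
    rintro (k | k)
    · exact h.law_fst k (hW k k.2)
    · exact h.law_snd k (hW k k.2)
  have hm : ∀ i : W ⊕ W, AEMeasurable
      (fun ω => Sum.elim (fun k : W => g k ω) (fun k : W => g' k ω) i) P :=
    fun i => (hlaw i).aemeasurable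
  refine ⟨aemeasurable_pi_lambda _ hm, ?_⟩
  let e : W → {k : ℕ // 1 ≤ k} := fun k => ⟨k, hW k k.2⟩
  have he : Function.Injective e := fun k l hkl => Subtype.ext (congrArg (fun m : {k : ℕ // 1 ≤ k} => m.1) hkl)
  have hind := h.indep.precomp (g := Sum.map e e) (Sum.map_injective.2 ⟨he, he⟩)
  have hind' : iIndepFun (fun (i : W ⊕ W) ω =>
      Sum.elim (fun k : W => g k ω) (fun k : W => g' k ω) i) P := by
    convert hind using 1
    funext i ω
    rcases i with k | k <;> rfl
  rw [(iIndepFun_iff_map_fun_eq_pi_map hm).1 hind']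
  unfold stdGaussianPi
  congr 1
  funext i
  exact (hlaw i).map_eq

end Law

/-! ### Small deviation bounds and the fourth-power condition. -/

section Supremum

/-- The coefficients of the normalised variables `X (τ i) / √A` in terms of the `g_k, g'_k`. -/
noncomputable def trigCoeff {n : Type*} (W : Finset ℕ) (a : ℕ → ℝ) (j : ℕ → ℤ) (A : ℝ) (τ : n → ℝ)
    (i : n) : W ⊕ W → ℝ :=
  Sum.elim (fun k => a k * Real.cos (2 * Real.pi * j k * τ i) / √A)
    (fun k => a k * Real.sin (2 * Real.pi * j k * τ i) / √A)

/-- Stationarity, from `cos u cos v + sin u sin v = cos (u - v)`; the diagonal case gives unit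
variance. -/
theorem sum_trigCoeff_mul {n : Type*} {W : Finset ℕ} {a : ℕ → ℝ} {j : ℕ → ℤ} {A : ℝ} (hA : 0 < A)
    (τ : n → ℝ) (i i' : n) :
    ∑ k, trigCoeff W a j A τ i k * trigCoeff W a j A τ i' k =
      trigCov W a j (τ i - τ i') / A := by
  have hs : √A * √A = A := Real.mul_self_sqrt hA.le
  have hs0 : √A ≠ 0 := (Real.sqrt_pos.2 hA).ne'
  rw [Fintype.sum_sum_type, ← Finset.sum_add_distrib, trigCov, Finset.sum_div,
    ← Finset.sum_coe_sort W]
  refine Finset.sum_congr rfl fun k _ => ?_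
  simp only [trigCoeff, Sum.elim_inl, Sum.elim_inr]
  rw [mul_sub, Real.cos_sub, div_mul_div_comm, div_mul_div_comm, hs]
  ring

theorem linForm_trigCoeff {Ω n : Type*} {W : Finset ℕ} {a : ℕ → ℝ} {j : ℕ → ℤ} {A : ℝ} (τ : n → ℝ)
    (i : n) (g g' : ℕ → Ω → ℝ) (ω : Ω) :
    linForm (trigCoeff W a j A τ) i
      (fun i : W ⊕ W => Sum.elim (fun k : W => g k ω) (fun k : W => g' k ω) i) =
      (∑ k ∈ W, a k * (g k ω * Real.cos (2 * Real.pi * j k * τ i)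
        + g' k ω * Real.sin (2 * Real.pi * j k * τ i))) / √A := by
  rw [linForm, Fintype.sum_sum_type, ← Finset.sum_add_distrib, Finset.sum_div,
    ← Finset.sum_coe_sort W]
  refine Finset.sum_congr rfl fun k _ => ?_
  simp only [trigCoeff, Sum.elim_inl, Sum.elim_inr]
  ring

theorem rpow_stdCdf_le_exp {z e : ℝ} (he : 0 ≤ e) :
    stdCdf z ^ e ≤ Real.exp (-(e * (1 - stdCdf z))) := by
  have h1 : stdCdf z ≤ Real.exp (-(1 - stdCdf z)) := by
    have := Real.add_one_le_exp (-(1 - stdCdf z))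
    linarith
  calc stdCdf z ^ e ≤ Real.exp (-(1 - stdCdf z)) ^ e :=
        Real.rpow_le_rpow (stdCdf_nonneg z) h1 he
    _ = _ := by rw [← Real.exp_mul]; congr 1; ring

/-- The small deviation bound of a Gaussian trigonometric polynomial in terms of the Gaussian
tail. -/
theorem measureReal_forall_le {Ω : Type*} [MeasurableSpace Ω] {P : Measure Ω}
    [IsProbabilityMeasure P] {g g' : ℕ → Ω → ℝ} (hg : IsStdGaussianPair P g g') {W : Finset ℕ}
    (hW : ∀ k ∈ W, 1 ≤ k) {a : ℕ → ℝ} {j : ℕ → ℤ} (hj : Set.InjOn j W) {A : ℝ} (hA : 0 < A)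
    (hAW : ∑ k ∈ W, a k ^ 2 = A) {ε z : ℝ} (hε : 0 < ε) (hε1 : ε ≤ 1) (hz : 0 ≤ z) :
    P.real {ω | ∀ t ∈ Set.Icc 0 ε, ∑ k ∈ W, a k * (g k ω * Real.cos (2 * Real.pi * j k * t)
        + g' k ω * Real.sin (2 * Real.pi * j k * t)) ≤ √A * z} ≤
      Real.exp (-(ε * A / (12 * √(∑ k ∈ W, a k ^ 4 + 1)) * (1 - stdCdf z))) := by
  set S := ∑ k ∈ W, a k ^ 4
  have hS : 0 ≤ S := Finset.sum_nonneg fun k _ => by positivity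
  have hS1 : 0 < √(S + 1) := Real.sqrt_pos.2 (by linarith)
  -- The mean of `f` is at most `ε / r`, so the greedy bound `m β / ε` stays at most 1 while `m ≤
  -- r`. With `N = ⌈r⌉₊`, every `m < N` satisfies this, and `N ≥ r`.
  set r := ε * A / √(S + 1) with hr
  have hr0 : 0 < r := by positivity
  set f : ℝ → ℝ := fun t => |trigCov W a j t| / A with hf
  have hfc : Continuous f := by
    have := continuous_trigCov W a j
    fun_prop
  have hf0 : ∀ t, 0 ≤ f t := fun t => by positivity
  have hfp : Function.Periodic f 1 := fun t => by
    simp only [hf, periodic_trigCov W a j t]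
  have hfe : ∀ t, f (-t) = f t := fun t => by simp only [hf, trigCov_neg]
  have hf1 : f 0 ≤ 1 := by
    simp only [hf, trigCov_zero, hAW]
    rw [abs_of_pos hA, div_self hA.ne']
  have hβ : ∫ u in (0 : ℝ)..1, f u ≤ ε / r := by
    simp only [hf]
    rw [intervalIntegral.integral_div, hr]
    have h1 : ε / (ε * A / √(S + 1)) = √(S + 1) / A := by field_simp
    rw [h1]
    gcongr
    exact (integral_abs_trigCov_le hj).trans (Real.sqrt_le_sqrt (by linarith))
  set N := ⌈r⌉₊
  obtain ⟨t, ht⟩ := exists_greedy_points hfc hf0 hfp hε hε1 N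
  have hrow : ∀ m < N, ∑ l ∈ Finset.range m, f (t m - t l) ≤ 1 := fun m hm => by
    refine (ht m hm).2.trans ?_
    have hmr : (m : ℝ) ≤ r := (Nat.lt_ceil.1 hm).le
    rw [div_le_one hε]
    calc (m : ℝ) * ∫ u in (0 : ℝ)..1, f u ≤ r * (ε / r) :=
          mul_le_mul hmr hβ (intervalIntegral.integral_nonneg zero_le_one fun u _ => hf0 u) hr0.le
      _ = ε := by field_simp
  have hcard := card_le_two_mul_card_filter (N := N)
    (r := fun i => ∑ l ∈ Finset.range N, f (t i - t l))
    (fun i => Finset.sum_nonneg fun l _ => hf0 _) (sum_sum_le_three_mul hfe hf1 hrow)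
  -- Discarding points only decreases row sums of the nonnegative `f`, so `p = 6` works on `T`.
  -- Since `T` has at least `N / 2` elements, the exponent is at least `r / 12`.
  set T := (Finset.range N).filter fun i => ∑ l ∈ Finset.range N, f (t i - t l) ≤ 6
  set τ : T → ℝ := fun i => t i with hτ
  set σ := trigCoeff W a j A τ
  have hσ : ∀ i, ∑ k, σ i k ^ 2 = 1 := fun i => by
    simp only [sq]
    rw [sum_trigCoeff_mul hA, sub_self, trigCov_zero, hAW, div_self hA.ne']
  have hR : ∀ v : T → ℝ, ∑ k, (∑ i, v i * σ i k) ^ 2 ≤ 6 * ∑ i, v i ^ 2 := fun v => by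
    have e : ∑ k, (∑ i, v i * σ i k) ^ 2 =
        ∑ i, ∑ i', v i * v i' * (trigCov W a j (τ i - τ i') / A) := by
      calc ∑ k, (∑ i, v i * σ i k) ^ 2
          = ∑ k, ∑ i, ∑ i', v i * v i' * (σ i k * σ i' k) := by
            refine Finset.sum_congr rfl fun k _ => ?_
            rw [sq, Finset.sum_mul_sum]
            exact Finset.sum_congr rfl fun i _ => Finset.sum_congr rfl fun i' _ => by ring
        _ = ∑ i, ∑ i', ∑ k, v i * v i' * (σ i k * σ i' k) := by
            rw [Finset.sum_comm]
            exact Finset.sum_congr rfl fun i _ => Finset.sum_comm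
        _ = _ := by
            refine Finset.sum_congr rfl fun i _ => Finset.sum_congr rfl fun i' _ => ?_
            rw [← Finset.mul_sum, sum_trigCoeff_mul hA]
    rw [e]
    refine sum_sum_mul_le_of_row_sum_le
      (R := fun i i' => trigCov W a j (τ i - τ i') / A) (fun i i' => ?_) (fun i => ?_) v
    · rw [← trigCov_neg, neg_sub]
    · have h6 := (Finset.mem_filter.1 i.2).2
      refine le_trans ?_ h6
      calc ∑ i' : T, |trigCov W a j (τ i - τ i') / A| = ∑ i' : T, f (t i - t i') := by
            refine Finset.sum_congr rfl fun i' _ => ?_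
            rw [abs_div, abs_of_pos hA]
        _ = ∑ l ∈ T, f (t i - t l) := Finset.sum_coe_sort T fun l => f (t i - t l)
        _ ≤ _ := Finset.sum_le_sum_of_subset_of_nonneg (Finset.filter_subset _ _)
            fun l _ _ => hf0 _
  have hmain := measureReal_forall_linForm_le (by norm_num : (0 : ℝ) < 6) hσ hR hz
  obtain ⟨hmeas, hmap⟩ := hg.map_eq hW
  rw [← hmap, map_measureReal_apply_of_aemeasurable hmeas (measurableSet_linForm_le σ z)] at hmain
  refine (measureReal_mono (fun ω hω i => ?_)).trans (hmain.trans ?_)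
  · rw [linForm_trigCoeff, div_le_iff₀ (Real.sqrt_pos.2 hA), mul_comm z]
    exact hω _ (ht _ (Finset.mem_range.1 (Finset.mem_filter.1 i.2).1)).1
  · refine (rpow_stdCdf_le_exp (by positivity)).trans ?_
    rw [Fintype.card_coe]
    gcongr
    · linarith [stdCdf_le_one z]
    · have h1 : r ≤ N := Nat.le_ceil r
      have h2 : ε * A / (12 * √(S + 1)) = r / 12 := by rw [hr]; field_simp
      rw [h2]
      linarith

/-- The Gaussian tail at `√(2L)` is at least a constant times `exp (-L) / √L`. -/
theorem exists_tail_lower_bound {δ : ℝ} (hδ : 0 < δ) :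
    ∃ c : ℝ, 0 < c ∧ ∀ L : ℝ, δ ≤ L → c * (Real.exp (-L) / √L) ≤ 1 - stdCdf √(2 * L) := by
  -- For `z = √(2L)` one has `(z + 1/z)² / 2 = L + 1 + 1/(4L)`, and `L ≥ δ` bounds the last term.
  refine ⟨(√(2 * Real.pi))⁻¹ * (√2)⁻¹ * Real.exp (-(1 + 1 / (4 * δ))), by positivity,
    fun L hL => ?_⟩
  have hL0 : 0 < L := hδ.trans_le hL
  have hz : 0 < √(2 * L) := Real.sqrt_pos.2 (by positivity)
  refine le_trans ?_ (tail_le_one_sub_stdCdf hz)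
  have e1 : (√(2 * L) + (√(2 * L))⁻¹) ^ 2 / 2 = L + (1 + 1 / (4 * L)) := by
    have h2 : √(2 * L) ^ 2 = 2 * L := Real.sq_sqrt (by positivity)
    have h3 : (√(2 * L) + (√(2 * L))⁻¹) ^ 2 = √(2 * L) ^ 2 + 2 + (√(2 * L) ^ 2)⁻¹ := by
      field_simp
      ring
    rw [h3, h2]
    field_simp
    ring
  rw [neg_div, e1, Real.sqrt_mul zero_le_two L, mul_inv √2]
  have h4 : Real.exp (-(1 + 1 / (4 * δ))) * Real.exp (-L) ≤
      Real.exp (-(L + (1 + 1 / (4 * L)))) := by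
    rw [← Real.exp_add]
    apply Real.exp_le_exp.2
    have : 1 / (4 * L) ≤ 1 / (4 * δ) := by gcongr
    linarith
  calc _ = (√(2 * Real.pi))⁻¹ * ((√2)⁻¹ * (√L)⁻¹ *
        (Real.exp (-(1 + 1 / (4 * δ))) * Real.exp (-L))) := by ring
    _ ≤ _ := by gcongr

theorem one_le_of_mem_window {y x : ℝ} (hy : 1 ≤ y) {k : ℕ} (hk : k ∈ window y x) : 1 ≤ k := by
  have h1 := (Finset.mem_Icc.1 hk).1
  have h2 : (1 : ℝ) ≤ k := hy.trans ((Nat.le_ceil y).trans (by exact_mod_cast h1))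
  exact_mod_cast h2

/-- The bound for the level `√(2 A log (A / V))`. -/
theorem exists_measureReal_supTrigPoly_le {δ : ℝ} (hδ : 0 < δ) : ∃ C : ℝ, 0 < C ∧
    ∀ (Ω : Type*) [MeasurableSpace Ω] (P : Measure Ω) [IsProbabilityMeasure P]
      (g g' : ℕ → Ω → ℝ) (_ : IsStdGaussianPair P g g')
      (a : ℕ → ℝ) (j : ℕ → ℤ) (_ : StrictMonoOn j (Set.Ici 1))
      (y x ε : ℝ) (_ : 1 ≤ y) (_ : 0 < ε) (_ : ε ≤ 1)
      (V : ℝ) (_ : 0 < V) (_ : V < sumSq a y x) (_ : δ ≤ Real.log (sumSq a y x / V)),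
      P.real {ω | supTrigPoly a j g g' y x ε ω ≤
          √(2 * sumSq a y x * Real.log (sumSq a y x / V))}
        ≤ Real.exp (-(C * ε * V / √((sumFourth a y x + 1) * Real.log (sumSq a y x / V)))) := by
  obtain ⟨c, hc, htail⟩ := exists_tail_lower_bound hδ
  refine ⟨c / 12, by positivity, ?_⟩
  intro Ω _ P _ g g' hg a j hj y x ε hy hε hε1 V hV hVA hL
  set A := sumSq a y x
  set S := sumFourth a y x
  set L := Real.log (A / V)
  have hA : 0 < A := hV.trans hVA
  have hS : 0 ≤ S := Finset.sum_nonneg fun k _ => by positivity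
  have hL0 : 0 < L := hδ.trans_le hL
  have hW : ∀ k ∈ window y x, 1 ≤ k := fun k hk => one_le_of_mem_window hy hk
  have hinj : Set.InjOn j (window y x) := hj.injOn.mono fun k hk => hW k hk
  have h := measureReal_forall_le hg hW (a := a) hinj hA rfl hε hε1 (Real.sqrt_nonneg (2 * L))
  refine (measureReal_mono (fun ω hω t ht => ?_)).trans (h.trans ?_)
  · rw [← Real.sqrt_mul hA.le, ← mul_assoc, mul_comm A 2]
    exact (le_csSup (bddAbove_trigPoly a j g g' y x ε ω) (Set.mem_image_of_mem _ ht)).trans hω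
  · have hexp : Real.exp (-L) = V / A := by
      rw [Real.exp_neg, Real.exp_log (by positivity), inv_div]
    have h1 := htail L hL
    rw [hexp] at h1
    apply Real.exp_le_exp.2
    apply neg_le_neg
    change _ ≤ ε * A / (12 * √(S + 1)) * (1 - stdCdf √(2 * L))
    have hS1 : 0 < √(S + 1) := Real.sqrt_pos.2 (by linarith)
    have hL1 : 0 < √L := Real.sqrt_pos.2 hL0
    calc c / 12 * ε * V / √((S + 1) * L) = ε * A / (12 * √(S + 1)) * (c * (V / A / √L)) := by
          rw [Real.sqrt_mul (by linarith)]
          field_simp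
      _ ≤ _ := by gcongr

/-- A finite partial sum of nonnegative terms, once indices are shifted by one: the series starts at
`a 1`, and `y ≥ 1` keeps index 0 out of the window. -/
theorem sumFourth_le_of_hasSum {a : ℕ → ℝ} {B y x : ℝ} (hy : 1 ≤ y)
    (hB : HasSum (fun k : ℕ => a (k + 1) ^ 4) B) : sumFourth a y x ≤ B := by
  have h1 : sumFourth a y x = ∑ k ∈ (window y x).image (fun k => k - 1), a (k + 1) ^ 4 := by
    rw [Finset.sum_image]
    · refine Finset.sum_congr rfl fun k hk => ?_
      rw [Nat.sub_add_cancel (one_le_of_mem_window hy hk)]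
    · intro k hk l hl hkl
      have := one_le_of_mem_window hy hk
      have := one_le_of_mem_window hy hl
      simp only at hkl
      omega
  rw [h1]
  exact sum_le_hasSum _ (fun k _ => by positivity) hB

open Filter in
theorem exists_forall_fourthCondition {η B : ℝ} (hη : η < 1) :
    ∃ A₀ : ℝ, ∀ a : ℕ → ℝ, HasSum (fun k : ℕ => a (k + 1) ^ 4) B →
      ∀ y x : ℝ, 1 ≤ y → A₀ ≤ sumSq a y x → FourthCondition a η y x := by
  have hlo := isLittleO_log_rpow_atTop (r := 2 * (1 - η)) (by linarith)
  have hb : ∀ᶠ A : ℝ in atTop, √B * √(Real.log A) ≤ A ^ (1 - η) := by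
    -- Since `log A = o(A^(2(1-η)))`, eventually `(|B| + 1) log A ≤ A^(2(1-η))`; the square root of
    -- this gives the claim. The threshold depends on `η` and `B` alone.
    filter_upwards [hlo.bound (show (0 : ℝ) < 1 / (|B| + 1) by positivity),
      eventually_gt_atTop 1] with A hA hA1
    have hA0 : 0 < A := by linarith
    rw [Real.norm_of_nonneg (Real.log_nonneg hA1.le), Real.norm_of_nonneg (by positivity),
      one_div, ← div_eq_inv_mul, le_div_iff₀ (by positivity)] at hA
    rw [← Real.sqrt_mul' _ (Real.log_nonneg hA1.le)]
    apply Real.sqrt_le_iff.2 ⟨by positivity, ?_⟩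
    rw [← Real.rpow_natCast, ← Real.rpow_mul hA0.le, mul_comm (1 - η)]
    refine le_trans ?_ hA
    nlinarith [le_abs_self B, Real.log_nonneg hA1.le]
  obtain ⟨A₁, hA₁⟩ := (hb.and (eventually_gt_atTop 1)).exists_forall_of_atTop
  refine ⟨A₁, fun a ha y x hy hA => ?_⟩
  obtain ⟨h1, h2⟩ := hA₁ _ hA
  unfold FourthCondition
  rw [le_div_iff₀ (Real.sqrt_pos.2 (Real.log_pos h2))]
  refine le_trans ?_ h1
  gcongr
  exact sumFourth_le_of_hasSum hy ha

end Supremum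

/-! ### The main theorem. -/

theorem mainTheorem2 :
    (∀ δ : ℝ, 0 < δ → ∃ C : ℝ, 0 < C ∧
      ∀ (Ω : Type*) [MeasurableSpace Ω] (P : Measure Ω) [IsProbabilityMeasure P]
        (g g' : ℕ → Ω → ℝ) (_ : IsStdGaussianPair P g g')
        (a : ℕ → ℝ) (j : ℕ → ℤ) (_ : StrictMonoOn j (Set.Ici 1))
        (y x ε : ℝ) (_ : 1 ≤ y) (_ : y ≤ x) (_ : 0 < ε) (_ : ε ≤ 1),
        -- (1), under the condition on the fourth powers
        (∀ η : ℝ, 0 < η → η < 1 → δ ≤ η * Real.log (sumSq a y x) → FourthCondition a η y x →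
          P.real {ω | supTrigPoly a j g g' y x ε ω
              ≤ √(2 * η * sumSq a y x * Real.log (sumSq a y x))}
            ≤ Real.exp (-(C * ε * sumSq a y x ^ (1 - η)
                / √(η * (sumFourth a y x + 1) * Real.log (sumSq a y x))))) ∧
        -- (1), when the fourth powers are summable
        (∀ η B : ℝ, 0 < η → η < 1 → δ ≤ η * Real.log (sumSq a y x) →
          HasSum (fun k : ℕ => a (k + 1) ^ 4) B →
          P.real {ω | supTrigPoly a j g g' y x ε ω
              ≤ √(2 * η * sumSq a y x * Real.log (sumSq a y x))}
            ≤ Real.exp (-(C * ε * sumSq a y x ^ (1 - η)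
                / √(η * (B + 1) * Real.log (sumSq a y x))))) ∧
        -- (2)
        (∀ V : ℝ, 0 < V → V < sumSq a y x → δ ≤ Real.log (sumSq a y x / V) →
          P.real {ω | supTrigPoly a j g g' y x ε ω
              ≤ √(2 * sumSq a y x * Real.log (sumSq a y x / V))}
            ≤ Real.exp (-(C * ε * V
                / √((sumFourth a y x + 1) * Real.log (sumSq a y x / V)))))) ∧
    -- if the fourth powers are summable, the condition holds as soon as `A(y,x)` is large
    (∀ η B : ℝ, 0 < η → η < 1 → ∃ A₀ : ℝ, ∀ a : ℕ → ℝ,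
      HasSum (fun k : ℕ => a (k + 1) ^ 4) B →
      ∀ y x : ℝ, 1 ≤ y → y ≤ x → A₀ ≤ sumSq a y x → FourthCondition a η y x) := by
  refine ⟨fun δ hδ => ?_, fun η B _ hη => ?_⟩
  · obtain ⟨C, hC, h⟩ := exists_measureReal_supTrigPoly_le hδ
    refine ⟨C, hC, ?_⟩
    intro Ω _ P _ g g' hg a j hj y x ε hy _ hε hε1
    have hpow : ∀ η : ℝ, 0 < η → η < 1 → δ ≤ η * Real.log (sumSq a y x) →
        P.real {ω | supTrigPoly a j g g' y x ε ω
            ≤ √(2 * η * sumSq a y x * Real.log (sumSq a y x))}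
          ≤ Real.exp (-(C * ε * sumSq a y x ^ (1 - η)
              / √(η * (sumFourth a y x + 1) * Real.log (sumSq a y x)))) := by
      intro η hη _ hL
      have hA0 : 0 ≤ sumSq a y x := Finset.sum_nonneg fun k _ => sq_nonneg _
      have hlog : 0 < Real.log (sumSq a y x) := pos_of_mul_pos_right (hδ.trans_le hL) hη.le
      have hA1 : 1 < sumSq a y x := (Real.log_pos_iff hA0).1 hlog
      have hApos : 0 < sumSq a y x := one_pos.trans hA1
      -- Part (1) is part (2) with `V = A^(1-η)`, for which `log (A / V) = η log A`.
      have hV : 0 < sumSq a y x ^ (1 - η) := Real.rpow_pos_of_pos hApos _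
      have hVA : sumSq a y x ^ (1 - η) < sumSq a y x := by
        conv_rhs => rw [← Real.rpow_one (sumSq a y x)]
        exact Real.rpow_lt_rpow_of_exponent_lt hA1 (by linarith)
      have e : Real.log (sumSq a y x / sumSq a y x ^ (1 - η)) = η * Real.log (sumSq a y x) := by
        rw [Real.log_div hApos.ne' hV.ne', Real.log_rpow hApos]
        ring
      have h2 := h Ω P g g' hg a j hj y x ε hy hε hε1 _ hV hVA (by rwa [e])
      rw [e] at h2
      rwa [show 2 * η * sumSq a y x * Real.log (sumSq a y x) =
          2 * sumSq a y x * (η * Real.log (sumSq a y x)) by ring,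
        show η * (sumFourth a y x + 1) * Real.log (sumSq a y x) =
          (sumFourth a y x + 1) * (η * Real.log (sumSq a y x)) by ring]
    refine ⟨fun η hη hη1 hL _ => hpow η hη hη1 hL, fun η B hη hη1 hL hB => ?_,
      fun V hV hVA hL => h Ω P g g' hg a j hj y x ε hy hε hε1 V hV hVA hL⟩
    refine (hpow η hη hη1 hL).trans ?_
    have hA0 : 0 ≤ sumSq a y x := Finset.sum_nonneg fun k _ => sq_nonneg _
    have hS : 0 ≤ sumFourth a y x := Finset.sum_nonneg fun k _ => by positivity
    have hSB : sumFourth a y x ≤ B := sumFourth_le_of_hasSum hy hB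
    have hlog : 0 < Real.log (sumSq a y x) := pos_of_mul_pos_right (hδ.trans_le hL) hη.le
    gcongr
  · obtain ⟨A₀, hA₀⟩ := exists_forall_fourthCondition (B := B) hη
    exact ⟨A₀, fun a ha y x hy _ hA => hA₀ a ha y x hy hA⟩
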